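/- Let $0<a<b$ and let $\alpha,\beta,t_0\in\mathbb R$. Put $\theta(x,t;z)=zx+(4\beta z^3+2\alpha z^2)t$, the phase of the Hirota equation $iq_t+\alpha(q_{xx}+2|q|^2q)+i\beta(q_{xxx}+6|q|^2q_x)=0$. Let $r$ be a real-valued function on $i[a,b]\cup i[-b,-a]$ which is continuous and bounded on $(ia,ib)$, with $r(z^*)=r(z)$. Let $p\ge 0$ be a continuous function on $[a,b]$ with $\int_a^b p=1$ and, for $N\ge 1$ and $1\le j\le N$, let $z_j=z_j^{(N)}\in[a,b]$ satisfy $\int_a^{z_j}p(s)\,ds=j/N$. **$N$-soliton potential.** Let $c_j=\frac{i(b-a)r(iz_j)}{N\pi}$, $C_j^{+}(x,t)=c_j e^{2i\theta(x,t;iz_j)}=c_je^{-2z_jx+(8\beta z_j^3-4i\alpha z_j^2)t}$ and $C_j^{-}(x,t)=-c_j^*e^{-2i\theta(x,t;-iz_j)}=-c_j^*e^{-2z_jx+(8\beta z_j^3+4i\alpha z_j^2)t}$. Consider the problem of finding a $2\times2$ matrix function $M(z)$, analytic off the points $\pm iz_j$, with $M(z)=\mathbb I+\mathcal O(z^{-1})$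 as $z\to\infty$, having at most simple poles at $\pm iz_j$, with $$\operatorname*{Res}_{z=iz_j}M=\lim_{z\to iz_j}M(z)\begin{pmatrix}0&0\\ C_j^{+}&0\end{pmatrix},\qquad \operatorname*{Res}_{z=-iz_j}M=\lim_{z\to -iz_j}M(z)\begin{pmatrix}0&C_j^{-}\\0&0\end{pmatrix}.$$ The $N$-soliton potential is $q_N(x,t)=2i\lim_{z\to\infty}zM_{12}(z)$. **Soliton gas potential.** Let $$F_+(x,t;z)=\frac{i(b-a)}{\pi}\int_a^b\frac{r(is)p(s)e^{2i\theta(x,t;is)}}{z-is}\,ds,\qquad F_-(x,t;z)=\frac{i(b-a)}{\pi}\int_{a}^{b}\frac{r(-is)p(s)e^{-2i\theta(x,t;-is)}}{z+is}\,ds ;$$ for equally spaced poles ($p=\frac1{b-a}$) these are $\frac1\pi\int_{ia}^{ib}\frac{r(k)e^{2i\theta(x,t;k)}}{z-k}dk$ and $\frac1\pi\int_{-ib}^{-ia}\frac{r(k)e^{-2i\theta(x,t;k)}}{z-k}dk$. Let $\frac{b-a}2<\varrho<\frac{a+b}2$ and let $\Gamma_\pm$ be the circle of radius $\varrho$ about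 $\pm i\frac{a+b}2$, with $\Gamma_+$ oriented counterclockwise and $\Gamma_-$ clockwise. Consider the problem of finding a $2\times 2$ matrix function $M(z)$, analytic off $\Gamma_+\cup\Gamma_-$, with continuous boundary values $M_\pm$ from the left/right side of $\Gamma_+\cup\Gamma_-$, with $M(z)=\mathbb I+\mathcal O(z^{-1})$ as $z\to\infty$ and $$M_+=M_-\begin{pmatrix}1&0\\-F_+&1\end{pmatrix}\ \text{on }\Gamma_+,\qquad M_+=M_-\begin{pmatrix}1&F_-\\0&1\end{pmatrix}\ \text{on }\Gamma_-.$$ The soliton gas potential is $q(x,t)=2i\lim_{z\to\infty}zM_{12}(z)$. **Claim.** There are constants $X$, $C$ and $c>0$, not depending on $x$ or $N$, such that for every $x\ge X$: 1. $|C_j^{\pm}(x,t_0)|\le Ce^{-cx}$ for all $N$ and $j$, and $|F_\pm(x,t_0;z)|\le Ce^{-cx}$ for all $z\in\Gamma_\pm$; 2. for every $N$ the first problem at $(x,t_0)$ is solvable, all its solutions give the same value $q_N(x,t_0)$, and $|q_N(x,t_0)|\le Ce^{-cx}$; 3. the second problem at $(x,t_0)$ is solvable, all its solutions give the same value $q(x,t_0)$,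 one has $q(x,t_0)=\lim_{N\to\infty}q_N(x,t_0)$, and $|q(x,t_0)|\le Ce^{-cx}$. In particular, at fixed $t=t_0$ the soliton gas potential $q(x,t_0)$ tends to zero exponentially fast as $x\to+\infty$. -/

import Mathlib

namespace SolitonGas

open Complex Filter Topology Asymptotics Bornology
open scoped Matrix

noncomputable section

/-- The phase `θ(x,t;z) = z x + (4 β z³ + 2 α z²) t` of the Hirota equation
`i q_t + α (q_xx + 2|q|² q) + i β (q_xxx + 6 |q|² q_x) = 0`. -/
def phase (α β x t : ℝ) (z : ℂ) : ℂ := z * x + (4 * β * z ^ 3 + 2 * α * z ^ 2) * t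

/-- The norming constant `c = i (b - a) r(i s) / (N π)` attached to the pole `i s`
of the `N`-soliton. -/
def normingConst (a b : ℝ) (r : ℂ → ℝ) (N : ℕ) (s : ℝ) : ℂ :=
  I * (b - a) * r (I * s) / (N * Real.pi)

/-- The coefficient `c e^{2 i θ(i s)} = c e^{-2 s x + (8 β s³ - 4 i α s²) t}` in the residue
condition at `i s`. -/
def upperCoeff (a b α β : ℝ) (r : ℂ → ℝ) (N : ℕ) (x t s : ℝ) : ℂ :=
  normingConst a b r N s * exp (2 * I * phase α β x t (I * s))

/-- The coefficient `-c* e^{-2 i θ(-i s)} = -c* e^{-2 s x + (8 β s³ + 4 i α s²) t}` in the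
residue condition at `-i s`. -/
def lowerCoeff (a b α β : ℝ) (r : ℂ → ℝ) (N : ℕ) (x t s : ℝ) : ℂ :=
  -(starRingEnd ℂ (normingConst a b r N s)) * exp (-(2 * I * phase α β x t (-(I * s))))

/-- `M` has at most a simple pole at `w`, with `Res_{z=w} M = lim_{z→w} M(z) A`. -/
def ResidueCondition (M : ℂ → Matrix (Fin 2) (Fin 2) ℂ) (w : ℂ)
    (A : Matrix (Fin 2) (Fin 2) ℂ) : Prop :=
  ∃ L : Matrix (Fin 2) (Fin 2) ℂ,
    Tendsto (fun z => M z * A) (𝓝[≠] w) (𝓝 L) ∧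
    Tendsto (fun z => (z - w) • M z) (𝓝[≠] w) (𝓝 L)

/-- `M(z) = I + O(1/z)` as `z → ∞`. -/
def Normalized (M : ℂ → Matrix (Fin 2) (Fin 2) ℂ) : Prop :=
  ∀ i j : Fin 2, (fun z => M z i j - (1 : Matrix (Fin 2) (Fin 2) ℂ) i j)
    =O[cobounded ℂ] (fun z => z⁻¹)

/-- `q = 2 i lim_{z→∞} z M(z)₁₂`. -/
def RecoveredFrom (M : ℂ → Matrix (Fin 2) (Fin 2) ℂ) (q : ℂ) : Prop :=
  Tendsto (fun z => 2 * I * (z * M z 0 1)) (cobounded ℂ) (𝓝 q)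

/-- The pure-soliton Riemann-Hilbert problem with the `2 N` poles `± i s_j`. -/
structure SolvesNSolitonRHP (a b α β : ℝ) (r : ℂ → ℝ) (N : ℕ) (s : Fin N → ℝ) (x t : ℝ)
    (M : ℂ → Matrix (Fin 2) (Fin 2) ℂ) : Prop where
  analytic : ∀ i j : Fin 2, DifferentiableOn ℂ (fun z => M z i j)
    {z : ℂ | ∀ k : Fin N, z ≠ I * s k ∧ z ≠ -(I * s k)}
  normalized : Normalized M
  residue_upper : ∀ k : Fin N,
    ResidueCondition M (I * s k) !![0, 0; upperCoeff a b α β r N x t (s k), 0]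
  residue_lower : ∀ k : Fin N,
    ResidueCondition M (-(I * s k)) !![0, lowerCoeff a b α β r N x t (s k); 0, 0]

/-- `q` is the value at `(x,t)` of the `N`-soliton potential: the Riemann-Hilbert problem is
solvable, and every solution of it gives the value `q`. -/
def IsNSolitonPotential (a b α β : ℝ) (r : ℂ → ℝ) (N : ℕ) (s : Fin N → ℝ) (x t : ℝ)
    (q : ℂ) : Prop :=
  (∃ M, SolvesNSolitonRHP a b α β r N s x t M) ∧
    ∀ M, SolvesNSolitonRHP a b α β r N s x t M → RecoveredFrom M q

/-- The `N → ∞` limit of `∑ⱼ upperCoeff / (z - i s_j)` when the `s_j` have density `p`. -/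
def upperCauchy (a b α β : ℝ) (r : ℂ → ℝ) (p : ℝ → ℝ) (x t : ℝ) (z : ℂ) : ℂ :=
  ∫ s in a..b, I * (b - a) * r (I * s) * p s / Real.pi *
    exp (2 * I * phase α β x t (I * s)) / (z - I * s)

/-- The `N → ∞` limit of `∑ⱼ lowerCoeff / (z + i s_j)` when the `s_j` have density `p`. -/
def lowerCauchy (a b α β : ℝ) (r : ℂ → ℝ) (p : ℝ → ℝ) (x t : ℝ) (z : ℂ) : ℂ :=
  ∫ s in a..b, I * (b - a) * r (-(I * s)) * p s / Real.pi *
    exp (-(2 * I * phase α β x t (-(I * s)))) / (z - -(I * s))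

/-- For equally spaced poles, i.e. the uniform density, `upperCauchy` is
`(1/π) ∫_{ia}^{ib} r(k) e^{2iθ(k)} / (z - k) dk` (with `k = i s`, `dk = i ds`). -/
theorem upperCauchy_uniform {a b : ℝ} (hab : a < b) (α β : ℝ) (r : ℂ → ℝ) (x t : ℝ) (z : ℂ) :
    upperCauchy a b α β r (fun _ => 1 / (b - a)) x t z =
      1 / Real.pi * ∫ s in a..b, r (I * s) * exp (2 * I * phase α β x t (I * s)) /
        (z - I * s) * I := by
  have h : (b : ℂ) - a ≠ 0 := by
    rw [sub_ne_zero]; exact_mod_cast hab.ne'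
  rw [upperCauchy, ← intervalIntegral.integral_const_mul]
  congr 1
  funext s
  push_cast
  field_simp

/-- For equally spaced poles `lowerCauchy` is
`(1/π) ∫_{-ib}^{-ia} r(k) e^{-2iθ(k)} / (z - k) dk` (with `k = i s`, `dk = i ds`). -/
theorem lowerCauchy_uniform {a b : ℝ} (hab : a < b) (α β : ℝ) (r : ℂ → ℝ) (x t : ℝ) (z : ℂ) :
    lowerCauchy a b α β r (fun _ => 1 / (b - a)) x t z =
      1 / Real.pi * ∫ s in (-b)..(-a), r (I * s) * exp (-(2 * I * phase α β x t (I * s))) /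
        (z - I * s) * I := by
  have h : (b : ℂ) - a ≠ 0 := by
    rw [sub_ne_zero]; exact_mod_cast hab.ne'
  rw [lowerCauchy, ← intervalIntegral.integral_comp_neg, ← intervalIntegral.integral_const_mul]
  congr 1
  funext s
  push_cast
  rw [mul_neg]
  field_simp

/-- The centre `i (a + b) / 2` of the circle `Γ₊`; the circle `Γ₋` has the opposite centre. -/
def centre (a b : ℝ) : ℂ := I * ((a + b) / 2)

/-- The soliton gas Riemann-Hilbert problem. The contours are the circles `Γ₊`, `Γ₋` of radius
`ρ` about `± i (a+b)/2`; `Γ₊` is oriented counterclockwise (its `+` side is the inside) and `Γ₋`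
clockwise (its `+` side is the outside). Limits at every point of the circles, from all of
either side, make the boundary values continuous. -/
structure SolvesGasRHP (a b α β ρ : ℝ) (r : ℂ → ℝ) (p : ℝ → ℝ) (x t : ℝ)
    (M : ℂ → Matrix (Fin 2) (Fin 2) ℂ) : Prop where
  analytic : ∀ i j : Fin 2, DifferentiableOn ℂ (fun z => M z i j)
    (Metric.sphere (centre a b) ρ ∪ Metric.sphere (-centre a b) ρ)ᶜ
  normalized : Normalized M
  jump_upper : ∀ z ∈ Metric.sphere (centre a b) ρ, ∃ Mplus Mminus : Matrix (Fin 2) (Fin 2) ℂ,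
    Tendsto M (𝓝[Metric.ball (centre a b) ρ] z) (𝓝 Mplus) ∧
    Tendsto M (𝓝[(Metric.closedBall (centre a b) ρ)ᶜ] z) (𝓝 Mminus) ∧
    Mplus = Mminus * !![1, 0; -upperCauchy a b α β r p x t z, 1]
  jump_lower : ∀ z ∈ Metric.sphere (-centre a b) ρ, ∃ Mplus Mminus : Matrix (Fin 2) (Fin 2) ℂ,
    Tendsto M (𝓝[(Metric.closedBall (-centre a b) ρ)ᶜ] z) (𝓝 Mplus) ∧
    Tendsto M (𝓝[Metric.ball (-centre a b) ρ] z) (𝓝 Mminus) ∧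
    Mplus = Mminus * !![1, lowerCauchy a b α β r p x t z; 0, 1]

/-- `q` is the value at `(x,t)` of the potential given by the soliton gas Riemann-Hilbert
problem: the problem is solvable, and every solution of it gives the value `q`. -/
def IsGasPotential (a b α β ρ : ℝ) (r : ℂ → ℝ) (p : ℝ → ℝ) (x t : ℝ) (q : ℂ) : Prop :=
  (∃ M, SolvesGasRHP a b α β ρ r p x t M) ∧
    ∀ M, SolvesGasRHP a b α β ρ r p x t M → RecoveredFrom M q

end

end SolitonGas

/-! Both Riemann-Hilbert problems are the same pair of integral equations, written for two different
measures. Look for row `i` of the solution with first column `e + ∫ wp(y) g(y) / (z - iy) dμ(y)` and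
second column `d + ∫ wm(y) f(y) / (z + iy) dμ(y)`, where `(e, d)` is row `i` of the identity, `f(s)`
is the first column at `-is` and `g(s)` is the second column at `is`. Evaluating at these points
closes the system for `(f, g)`. Its kernel `1 / (i(s + y))` is bounded by `1 / (2a)`, because the
singular sets `i[a,b]` and `-i[a,b]` are separated.

For `x ≥ 0` the phase factors on these segments are at most a constant times `e^{-2ax}`. For large
`x` the weights therefore have total mass at most `a`, and the system is a contraction of ratio
`1/2` in the sup norm (`SmallData.contracting`). The potential is `2i ∫ wm f dμ`, at most `4 ∫ |wm|
dμ`, hence exponentially small uniformly in `N`.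

With `μ` a sum of point masses the ansatz has exactly the prescribed residues
(`solves_solitonMatrix`). With Lebesgue measure on `[a,b]` it solves the gas problem outside the
circles. Inside a circle one column is corrected by `F₊` or `F₋` times the other, and a partial
fraction identity (`cauchyTransform_sub_mul`) shows that the correction removes the cut
(`solves_gasMatrix`).

Uniqueness: for two solutions, `M adj(M')` has neither poles nor jumps and tends to the identity, so
Liouville's theorem makes it the identity; taking `M = M'` also gives `det M' = 1`.

For `N → ∞`, the fixed points converge as soon as the operators converge on each fixed function
(`SmallData.tendsto_potential`). That convergence comes from transporting the density `p` onto the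
quantiles by maps tending to the identity where `p > 0` (`exists_transport`,
`exists_uniform_quantile_bound`). -/

namespace SolitonGas

open Complex Filter Topology Asymptotics Bornology MeasureTheory
open scoped Matrix

/-! ### Removable singularities: finite sets and circles -/

section Removable

/-- Painlevé: a continuous function which is holomorphic off a circle is holomorphic. -/
theorem differentiableOn_ball_of_off_sphere {g : ℂ → ℂ} {c : ℂ} {ρ R : ℝ} (hρ : 0 < ρ)
    (hg : Continuous g)
    (hd : ∀ z ∈ Metric.ball c R, z ∉ Metric.sphere c ρ → DifferentiableAt ℂ g z) :
    DifferentiableOn ℂ g (Metric.ball c R) := by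
  intro z₀ hz₀
  apply DifferentiableAt.differentiableWithinAt
  by_cases hs : z₀ ∉ Metric.sphere c ρ
  · exact hd z₀ hz₀ hs
  rw [not_not, mem_sphere_iff_norm] at hs
  have hρR : ρ < R := by
    rw [← hs]; simpa [dist_eq_norm] using hz₀
  obtain ⟨R', h1, h2⟩ := exists_between hρR
  have hR' : 0 < R' := hρ.trans h1
  -- Cauchy's formula off the circle. `dslope g w` is holomorphic off the circle and `w`. Cauchy's
  -- theorem on the annulus moves its integral from radius `R'` to radius `ρ`, and on the disc makes
  -- it vanish. Both need only continuity up to the boundary, so the bad circle may be a boundary.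
  have key : ∀ w ∈ Metric.ball c R', w ∉ Metric.sphere c ρ →
      (2 * ↑Real.pi * I)⁻¹ • ∮ z in C(c, R'), (z - w)⁻¹ • g z = g w := by
    intro w hw hws
    have hdw : DifferentiableAt ℂ g w := hd w (Metric.ball_subset_ball h2.le hw) hws
    have hcont : Continuous (dslope g w) := by
      rw [← continuousOn_univ, continuousOn_dslope univ_mem]
      exact ⟨hg.continuousOn, hdw⟩
    have hdiff : ∀ z ∈ Metric.ball c R, z ∉ Metric.sphere c ρ → z ≠ w →
        DifferentiableAt ℂ (dslope g w) z := fun z hz hzs hzw =>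
      (differentiableAt_dslope_of_ne hzw).2 (hd z hz hzs)
    have e1 : ∮ z in C(c, R'), dslope g w z = ∮ z in C(c, ρ), dslope g w z := by
      refine circleIntegral_eq_of_differentiable_on_annulus_off_countable hρ h1.le
        (Set.countable_singleton w) hcont.continuousOn ?_
      rintro z ⟨⟨hz1, hz2⟩, hz3⟩
      exact hdiff z (Metric.ball_subset_ball h2.le hz1)
        (fun h => hz2 (Metric.sphere_subset_closedBall h)) hz3
    have e2 : ∮ z in C(c, ρ), dslope g w z = 0 := by
      refine circleIntegral_eq_zero_of_differentiable_on_off_countable hρ.le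
        (Set.countable_singleton w) hcont.continuousOn ?_
      rintro z ⟨hz1, hz3⟩
      refine hdiff z (Metric.ball_subset_ball hρR.le hz1) (fun h => ?_) hz3
      rw [Metric.mem_ball] at hz1
      exact hz1.ne h
    have hne : ∀ z ∈ Metric.sphere c R', z ≠ w := by
      rintro z hz rfl
      rw [Metric.mem_ball] at hw
      exact hw.ne hz
    have hinv : ContinuousOn (fun z => (z - w)⁻¹) (Metric.sphere c R') :=
      ContinuousOn.inv₀ (by fun_prop) fun z hz => sub_ne_zero.2 (hne z hz)
    have e3 : ∮ z in C(c, R'), dslope g w z =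
        (∮ z in C(c, R'), (z - w)⁻¹ • g z) - ∮ z in C(c, R'), (z - w)⁻¹ • g w := by
      rw [← circleIntegral.integral_sub]
      · refine circleIntegral.integral_congr hR'.le fun z hz => ?_
        simp only [dslope_of_ne _ (hne z hz), slope_def_module, smul_sub]
      · exact ContinuousOn.circleIntegrable hR'.le (hinv.smul hg.continuousOn)
      · exact ContinuousOn.circleIntegrable hR'.le (hinv.smul continuousOn_const)
    have e4 : ∮ z in C(c, R'), (z - w)⁻¹ • g w = (2 * ↑Real.pi * I) • g w := by
      rw [circleIntegral.integral_smul_const, circleIntegral.integral_sub_inv_of_mem_ball hw]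
    rw [e1, e2, e4] at e3
    rw [sub_eq_zero.1 e3.symm, smul_smul, inv_mul_cancel₀ two_pi_I_ne_zero, one_smul]
  set h : ℂ → ℂ := fun w => (2 * ↑Real.pi * I)⁻¹ • ∮ z in C(c, R'), (z - w)⁻¹ • g z
  have hh : DifferentiableOn ℂ h (Metric.ball c R') := by
    have := (hasFPowerSeriesOn_cauchy_integral (f := g) (c := c) (R := R'.toNNReal)
      (ContinuousOn.circleIntegrable (NNReal.coe_nonneg _) hg.continuousOn)
      (Real.toNNReal_pos.2 hR')).differentiableOn
    rwa [Metric.eball_coe, Real.coe_toNNReal _ hR'.le] at this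
  have hz₀' : z₀ ∈ Metric.ball c R' := by
    rw [Metric.mem_ball, dist_eq_norm, hs]; exact h1
  have heq : Set.EqOn h g (Metric.ball c R') := by
    have hdense : Dense (Metric.sphere c ρ)ᶜ := by
      rw [← interior_eq_empty_iff_dense_compl]
      exact interior_sphere c hρ.ne'
    refine Set.EqOn.of_subset_closure (s := Metric.ball c R' ∩ (Metric.sphere c ρ)ᶜ)
      (fun w hw => key w hw.1 hw.2) hh.continuousOn hg.continuousOn Set.inter_subset_left ?_
    exact hdense.open_subset_closure_inter Metric.isOpen_ball
  exact ((hh.congr fun z hz => (heq hz).symm).differentiableAt (Metric.isOpen_ball.mem_nhds hz₀'))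

/-- Liouville's theorem with a bounded, removable exceptional set. -/
theorem eq_of_removable {S : Set ℂ} (hSb : Bornology.IsBounded S)
    (hdense : Dense Sᶜ)
    (hrem : ∀ g : ℂ → ℂ, Continuous g → DifferentiableOn ℂ g Sᶜ → Differentiable ℂ g)
    {f : ℂ → ℂ} (hf : DifferentiableOn ℂ f Sᶜ)
    (hlim : ∀ z ∈ S, ∃ y, Tendsto f (𝓝[Sᶜ] z) (𝓝 y)) {c : ℂ}
    (hc : Tendsto f (cobounded ℂ) (𝓝 c)) : ∀ z ∈ Sᶜ, f z = c := by
  have hext : ∀ z ∈ Sᶜ, extendFrom Sᶜ f z = f z := extendFrom_extends hf.continuousOn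
  have hcont : Continuous (extendFrom Sᶜ f) := by
    refine continuous_extendFrom hdense fun z => ?_
    by_cases hz : z ∈ S
    · exact hlim z hz
    · exact ⟨f z, hf.continuousOn z hz⟩
  have hdiff : Differentiable ℂ (extendFrom Sᶜ f) := hrem _ hcont (hf.congr hext)
  intro z hz
  rw [← hext z hz]
  refine hdiff.apply_eq_of_tendsto_cocompact z ?_
  rw [← Metric.cobounded_eq_cocompact]
  refine hc.congr' ?_
  filter_upwards [isBounded_def.1 hSb] with w hw using (hext w hw).symm

/-- Riemann's removable singularity theorem. -/
theorem exists_tendsto_of_removable {f : ℂ → ℂ} {w : ℂ}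
    (hd : ∀ᶠ z in 𝓝[≠] w, DifferentiableAt ℂ f z)
    (h0 : Tendsto (fun z => (z - w) * f z) (𝓝[≠] w) (𝓝 0)) :
    ∃ l, Tendsto f (𝓝[≠] w) (𝓝 l) := by
  refine ⟨_, tendsto_limUnder_of_differentiable_on_punctured_nhds_of_isLittleO hd ?_⟩
  rw [isLittleO_iff_tendsto']
  · have h2 : Tendsto (fun z => (z - w) * f w) (𝓝[≠] w) (𝓝 0) := by
      have : Tendsto (fun z => (z - w) * f w) (𝓝 w) (𝓝 ((w - w) * f w)) :=
        Continuous.tendsto (by fun_prop) w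
      rw [sub_self, zero_mul] at this
      exact this.mono_left nhdsWithin_le_nhds
    have := h0.sub h2
    rw [sub_zero] at this
    refine this.congr fun z => ?_
    rw [div_inv_eq_mul]; ring
  · filter_upwards [self_mem_nhdsWithin] with z hz h
    exact absurd (inv_eq_zero.1 h) (sub_ne_zero.2 hz)

theorem eventually_differentiableAt_of_finite {S : Set ℂ} (hS : S.Finite) {f : ℂ → ℂ}
    (hf : DifferentiableOn ℂ f Sᶜ) (w : ℂ) : ∀ᶠ z in 𝓝[≠] w, DifferentiableAt ℂ f z := by
  have hloc : (S \ {w})ᶜ ∈ 𝓝 w :=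
    (hS.subset Set.sdiff_subset).isClosed.isOpen_compl.mem_nhds (by simp)
  filter_upwards [mem_nhdsWithin_of_mem_nhds hloc, self_mem_nhdsWithin] with z hz hzw
  exact hf.differentiableAt (hS.isClosed.isOpen_compl.mem_nhds fun h => hz ⟨h, hzw⟩)

theorem differentiable_of_off_finite {S : Set ℂ} (hS : S.Finite) {g : ℂ → ℂ} (hg : Continuous g)
    (hd : DifferentiableOn ℂ g Sᶜ) : Differentiable ℂ g := fun z =>
  (analyticAt_of_differentiable_on_punctured_nhds_of_continuousAt
    (eventually_differentiableAt_of_finite hS hd z) hg.continuousAt).differentiableAt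

/-- A function with finitely many singularities, all removable, and a limit at infinity is
constant. -/
theorem eq_of_finite_removable {S : Set ℂ} (hS : S.Finite) {f : ℂ → ℂ}
    (hf : DifferentiableOn ℂ f Sᶜ)
    (hlim : ∀ w ∈ S, Tendsto (fun z => (z - w) * f z) (𝓝[≠] w) (𝓝 0)) {c : ℂ}
    (hc : Tendsto f (cobounded ℂ) (𝓝 c)) : ∀ z ∈ Sᶜ, f z = c := by
  refine eq_of_removable hS.isBounded (hS.countable.dense_compl ℝ)
    (fun g hg hd => differentiable_of_off_finite hS hg hd) hf (fun w hw => ?_) hc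
  obtain ⟨l, hl⟩ := exists_tendsto_of_removable (eventually_differentiableAt_of_finite hS hf w)
    (hlim w hw)
  exact ⟨l, hl.mono_left (nhdsWithin_mono _ fun z hz h => hz (h ▸ hw))⟩

/-- A function holomorphic off two disjoint circles, with matching limits from both sides of the
circles and a limit at infinity, is constant. -/
theorem eq_of_circles_removable {c : ℂ} {ρ R : ℝ} (hρ : 0 < ρ) (hρR : ρ < R)
    (hR : R ≤ ‖c‖) {f : ℂ → ℂ}
    (hf : DifferentiableOn ℂ f (Metric.sphere c ρ ∪ Metric.sphere (-c) ρ)ᶜ)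
    (h1 : ∀ z ∈ Metric.sphere c ρ, ∃ y, Tendsto f (𝓝[Metric.ball c ρ] z) (𝓝 y) ∧
      Tendsto f (𝓝[(Metric.closedBall c ρ)ᶜ] z) (𝓝 y))
    (h2 : ∀ z ∈ Metric.sphere (-c) ρ, ∃ y, Tendsto f (𝓝[Metric.ball (-c) ρ] z) (𝓝 y) ∧
      Tendsto f (𝓝[(Metric.closedBall (-c) ρ)ᶜ] z) (𝓝 y)) {l : ℂ}
    (hl : Tendsto f (cobounded ℂ) (𝓝 l)) :
    ∀ z ∈ (Metric.sphere c ρ ∪ Metric.sphere (-c) ρ)ᶜ, f z = l := by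
  have hclosed : IsClosed (Metric.sphere c ρ ∪ Metric.sphere (-c) ρ) :=
    Metric.isClosed_sphere.union Metric.isClosed_sphere
  have hcc : dist c (-c) = 2 * ‖c‖ := by
    rw [dist_eq_norm, sub_neg_eq_add, ← two_mul, norm_mul]; simp
  have hsub : ∀ d : ℂ, (Metric.sphere c ρ ∪ Metric.sphere (-c) ρ)ᶜ ⊆
      Metric.ball d ρ ∪ (Metric.closedBall d ρ)ᶜ ∪ (Metric.sphere d ρ) := by
    intro d z _
    rcases lt_trichotomy (dist z d) ρ with h | h | h
    · exact Or.inl (Or.inl h)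
    · exact Or.inr h
    · exact Or.inl (Or.inr (by simpa using h))
  refine eq_of_removable ?_ ?_ ?_ hf ?_ hl
  · exact Metric.isBounded_sphere.union Metric.isBounded_sphere
  · rw [← interior_eq_empty_iff_dense_compl, interior_union_isClosed_of_interior_empty
      Metric.isClosed_sphere (interior_sphere _ hρ.ne')]
    exact interior_sphere _ hρ.ne'
  · intro g hg hd z
    -- The centres are `2‖c‖ ≥ 2R` apart, so the balls of radius `R` are disjoint and each meets
    -- only its own circle.
    by_cases hz : z ∈ Metric.ball c R ∨ z ∈ Metric.ball (-c) R
    · rcases hz with hz | hz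
      · refine (differentiableOn_ball_of_off_sphere (R := R) hρ hg (fun w hw hws => ?_)
          ).differentiableAt (Metric.isOpen_ball.mem_nhds hz)
        refine hd.differentiableAt (hclosed.isOpen_compl.mem_nhds ?_)
        rintro (h | h)
        · exact hws h
        · rw [Metric.mem_ball] at hw
          rw [Metric.mem_sphere] at h
          linarith [dist_triangle_left c (-c) w]
      · refine (differentiableOn_ball_of_off_sphere (R := R) hρ hg (fun w hw hws => ?_)
          ).differentiableAt (Metric.isOpen_ball.mem_nhds hz)
        refine hd.differentiableAt (hclosed.isOpen_compl.mem_nhds ?_)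
        rintro (h | h)
        · rw [Metric.mem_ball] at hw
          rw [Metric.mem_sphere] at h
          linarith [dist_triangle_left c (-c) w]
        · exact hws h
    · refine hd.differentiableAt (hclosed.isOpen_compl.mem_nhds ?_)
      rintro (h | h)
      · exact hz (Or.inl (Metric.sphere_subset_ball hρR h))
      · exact hz (Or.inr (Metric.sphere_subset_ball hρR h))
  · have aux : ∀ d z, z ∈ Metric.sphere d ρ →
        (Metric.sphere d ρ ⊆ Metric.sphere c ρ ∪ Metric.sphere (-c) ρ) →
        (∃ y, Tendsto f (𝓝[Metric.ball d ρ] z) (𝓝 y) ∧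
          Tendsto f (𝓝[(Metric.closedBall d ρ)ᶜ] z) (𝓝 y)) →
        ∃ y, Tendsto f (𝓝[(Metric.sphere c ρ ∪ Metric.sphere (-c) ρ)ᶜ] z) (𝓝 y) := by
      rintro d z hz hd ⟨y, hy1, hy2⟩
      refine ⟨y, Tendsto.mono_left (x := 𝓝[(Metric.ball d ρ ∪ (Metric.closedBall d ρ)ᶜ)] z) ?_
        (nhdsWithin_mono _ ?_)⟩
      · rw [nhdsWithin_union]; exact hy1.sup hy2
      · intro w hw
        rcases hsub d hw with h | h
        · exact h
        · exact absurd (hd h) hw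
    rintro z (hz | hz)
    · exact aux c z hz Set.subset_union_left (h1 z hz)
    · exact aux (-c) z hz Set.subset_union_right (h2 z hz)

end Removable

/-! ### Uniqueness for both Riemann-Hilbert problems -/

section Uniqueness

theorem Normalized.tendsto {M : ℂ → Matrix (Fin 2) (Fin 2) ℂ} (h : Normalized M) (i j : Fin 2) :
    Tendsto (fun z => M z i j) (cobounded ℂ) (𝓝 ((1 : Matrix (Fin 2) (Fin 2) ℂ) i j)) :=
  tendsto_sub_nhds_zero_iff.1 ((h i j).trans_tendsto tendsto_inv₀_cobounded)

theorem mul_adjugate_apply_zero (A B : Matrix (Fin 2) (Fin 2) ℂ) (i : Fin 2) :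
    (A * B.adjugate) i 0 = A i 0 * B 1 1 - A i 1 * B 1 0 := by
  rw [Matrix.adjugate_fin_two, Matrix.mul_apply, Fin.sum_univ_two]
  simp [sub_eq_add_neg]

theorem mul_adjugate_apply_one (A B : Matrix (Fin 2) (Fin 2) ℂ) (i : Fin 2) :
    (A * B.adjugate) i 1 = -(A i 0 * B 0 1 - A i 1 * B 0 0) := by
  rw [Matrix.adjugate_fin_two, Matrix.mul_apply, Fin.sum_univ_two]
  simp [neg_add_eq_sub]

/-- If `M adj(N) = 1` and `N adj(N) = 1` then `M = N`. -/
theorem eq_of_mul_adjugate_eq_one {A B : Matrix (Fin 2) (Fin 2) ℂ}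
    (h1 : A * B.adjugate = 1) (h2 : B * B.adjugate = 1) : A = B := by
  have h3 : B.adjugate * B = 1 := mul_eq_one_comm.1 h2
  calc A = A * (B.adjugate * B) := by rw [h3, mul_one]
    _ = B := by rw [← mul_assoc, h1, one_mul]

theorem tendsto_mul_adjugate {M N : ℂ → Matrix (Fin 2) (Fin 2) ℂ} (hM : Normalized M)
    (hN : Normalized N) (i j : Fin 2) :
    Tendsto (fun z => (M z * (N z).adjugate) i j) (cobounded ℂ)
      (𝓝 ((1 : Matrix (Fin 2) (Fin 2) ℂ) i j)) := by
  have h : ∀ i j, (1 : Matrix (Fin 2) (Fin 2) ℂ) i j =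
    ((1 : Matrix (Fin 2) (Fin 2) ℂ) * (1 : Matrix (Fin 2) (Fin 2) ℂ).adjugate) i j := by simp
  rw [h]
  fin_cases j
  · simp only [Fin.zero_eta, mul_adjugate_apply_zero]
    exact ((hM.tendsto i 0).mul (hN.tendsto 1 1)).sub ((hM.tendsto i 1).mul (hN.tendsto 1 0))
  · simp only [Fin.mk_one, mul_adjugate_apply_one]
    exact (((hM.tendsto i 0).mul (hN.tendsto 0 1)).sub
      ((hM.tendsto i 1).mul (hN.tendsto 0 0))).neg

theorem differentiableOn_mul_adjugate {M N : ℂ → Matrix (Fin 2) (Fin 2) ℂ} {S : Set ℂ}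
    (hM : ∀ i j, DifferentiableOn ℂ (fun z => M z i j) S)
    (hN : ∀ i j, DifferentiableOn ℂ (fun z => N z i j) S) (i j : Fin 2) :
    DifferentiableOn ℂ (fun z => (M z * (N z).adjugate) i j) S := by
  fin_cases j
  · simp only [Fin.zero_eta, mul_adjugate_apply_zero]
    exact ((hM i 0).mul (hN 1 1)).sub ((hM i 1).mul (hN 1 0))
  · simp only [Fin.mk_one, mul_adjugate_apply_one]
    exact (((hM i 0).mul (hN 0 1)).sub ((hM i 1).mul (hN 0 0))).neg

/-- For `C ≠ 0` the limit of the regular column is read off from `lim M A`. For `C = 0` that limit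
carries no information, but the residue is then zero and Riemann's theorem supplies the limit. -/
theorem ResidueCondition.upper {M : ℂ → Matrix (Fin 2) (Fin 2) ℂ} {w C : ℂ}
    (h : ResidueCondition M w !![0, 0; C, 0])
    (hd : ∀ i j, ∀ᶠ z in 𝓝[≠] w, DifferentiableAt ℂ (fun z => M z i j) z) (i : Fin 2) :
    ∃ l, Tendsto (fun z => M z i 1) (𝓝[≠] w) (𝓝 l) ∧
      Tendsto (fun z => (z - w) * M z i 0) (𝓝[≠] w) (𝓝 (C * l)) := by
  obtain ⟨L, h1, h2⟩ := h
  have h1' := ((continuous_id.matrix_elem i 0).tendsto L).comp h1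
  have h2' := fun j => ((continuous_id.matrix_elem i j).tendsto L).comp h2
  simp only [Function.comp_def, id, Matrix.mul_apply, Fin.sum_univ_two, Matrix.smul_apply,
    smul_eq_mul] at h1' h2'
  simp only [Matrix.of_apply, Matrix.cons_val', Matrix.cons_val_zero, Matrix.cons_val_one,
    Matrix.cons_val_fin_one, mul_zero, zero_add] at h1'
  by_cases hC : C = 0
  · have hz : L = 0 := by
      refine tendsto_nhds_unique h1 ?_
      have : (!![0, 0; C, 0] : Matrix (Fin 2) (Fin 2) ℂ) = 0 := by
        ext i j; fin_cases i <;> fin_cases j <;> simp [hC]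
      simp [this]
    subst hz
    obtain ⟨l, hl⟩ := exists_tendsto_of_removable (hd i 1) (h2' 1)
    exact ⟨l, hl, by simpa [hC] using h2' 0⟩
  · refine ⟨L i 0 / C, ?_, ?_⟩
    · refine (h1'.div_const C).congr fun z => ?_
      field_simp
    · rw [mul_div_cancel₀ _ hC]
      exact h2' 0

theorem ResidueCondition.lower {M : ℂ → Matrix (Fin 2) (Fin 2) ℂ} {w C : ℂ}
    (h : ResidueCondition M w !![0, C; 0, 0])
    (hd : ∀ i j, ∀ᶠ z in 𝓝[≠] w, DifferentiableAt ℂ (fun z => M z i j) z) (i : Fin 2) :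
    ∃ l, Tendsto (fun z => M z i 0) (𝓝[≠] w) (𝓝 l) ∧
      Tendsto (fun z => (z - w) * M z i 1) (𝓝[≠] w) (𝓝 (C * l)) := by
  obtain ⟨L, h1, h2⟩ := h
  have h1' := ((continuous_id.matrix_elem i 1).tendsto L).comp h1
  have h2' := fun j => ((continuous_id.matrix_elem i j).tendsto L).comp h2
  simp only [Function.comp_def, id, Matrix.mul_apply, Fin.sum_univ_two, Matrix.smul_apply,
    smul_eq_mul] at h1' h2'
  simp only [Matrix.of_apply, Matrix.cons_val', Matrix.cons_val_zero, Matrix.cons_val_one,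
    Matrix.cons_val_fin_one, mul_zero, add_zero] at h1'
  by_cases hC : C = 0
  · have hz : L = 0 := by
      refine tendsto_nhds_unique h1 ?_
      have : (!![0, C; 0, 0] : Matrix (Fin 2) (Fin 2) ℂ) = 0 := by
        ext i j; fin_cases i <;> fin_cases j <;> simp [hC]
      simp [this]
    subst hz
    obtain ⟨l, hl⟩ := exists_tendsto_of_removable (hd i 0) (h2' 0)
    exact ⟨l, hl, by simpa [hC] using h2' 1⟩
  · refine ⟨L i 1 / C, ?_, ?_⟩
    · refine (h1'.div_const C).congr fun z => ?_
      field_simp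
    · rw [mul_div_cancel₀ _ hC]
      exact h2' 1

/-- The poles `± i s_j` of the `N`-soliton. -/
def solitonPoles {N : ℕ} (s : Fin N → ℝ) : Set ℂ :=
  Set.range (fun k => I * (s k : ℂ)) ∪ Set.range (fun k => -(I * (s k : ℂ)))

theorem finite_solitonPoles {N : ℕ} (s : Fin N → ℝ) : (solitonPoles s).Finite :=
  (Set.finite_range _).union (Set.finite_range _)

theorem compl_solitonPoles {N : ℕ} (s : Fin N → ℝ) :
    (solitonPoles s)ᶜ = {z : ℂ | ∀ k : Fin N, z ≠ I * s k ∧ z ≠ -(I * s k)} := by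
  ext z
  simp only [solitonPoles, Set.mem_compl_iff, Set.mem_union, Set.mem_range, not_or, not_exists,
    Set.mem_ofPred_eq, forall_and, ne_eq, eq_comm]

/-- At a pole the singular column of each matrix has residue `C` times the limit of its regular
column. The entries of `M adj(M')` are 2×2 determinants in these columns, and their residues `C l l'
- l C l'` cancel. -/
theorem SolvesNSolitonRHP.mul_adjugate {a b α β : ℝ} {r : ℂ → ℝ} {N : ℕ} {s : Fin N → ℝ}
    {x t : ℝ} {M M' : ℂ → Matrix (Fin 2) (Fin 2) ℂ}
    (hM : SolvesNSolitonRHP a b α β r N s x t M) (hM' : SolvesNSolitonRHP a b α β r N s x t M') :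
    ∀ z ∈ (solitonPoles s)ᶜ, M z * (M' z).adjugate = 1 := by
  have hfin := finite_solitonPoles s
  have hd := fun i j => compl_solitonPoles s ▸ hM.analytic i j
  have hd' := fun i j => compl_solitonPoles s ▸ hM'.analytic i j
  have hed := fun w i j => eventually_differentiableAt_of_finite hfin (hd i j) w
  have hed' := fun w i j => eventually_differentiableAt_of_finite hfin (hd' i j) w
  have key : ∀ w ∈ solitonPoles s, ∀ i k,
      Tendsto (fun z => (z - w) * (M z i 0 * M' z k 1 - M z i 1 * M' z k 0)) (𝓝[≠] w) (𝓝 0) := by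
    rintro w (⟨k, rfl⟩ | ⟨k, rfl⟩) i j
    · obtain ⟨l, h1, h2⟩ := (hM.residue_upper k).upper (hed _) i
      obtain ⟨l', h1', h2'⟩ := (hM'.residue_upper k).upper (hed' _) j
      have := (h2.mul h1').sub (h1.mul h2')
      refine (this.congr fun z => by ring).mono_right (le_of_eq ?_)
      congr 1; ring
    · obtain ⟨l, h1, h2⟩ := (hM.residue_lower k).lower (hed _) i
      obtain ⟨l', h1', h2'⟩ := (hM'.residue_lower k).lower (hed' _) j
      have := (h1.mul h2').sub (h2.mul h1')
      refine (this.congr fun z => by ring).mono_right (le_of_eq ?_)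
      congr 1; ring
  intro z hz
  ext i j
  refine eq_of_finite_removable hfin (differentiableOn_mul_adjugate hd hd' i j) (fun w hw => ?_)
    (tendsto_mul_adjugate hM.normalized hM'.normalized i j) z hz
  fin_cases j
  · simpa only [Fin.zero_eta, mul_adjugate_apply_zero] using key w hw i 1
  · simpa only [Fin.mk_one, mul_adjugate_apply_one, mul_neg, neg_zero] using (key w hw i 0).neg

/-- The pure-soliton problem has at most one solution. -/
theorem SolvesNSolitonRHP.unique {a b α β : ℝ} {r : ℂ → ℝ} {N : ℕ} {s : Fin N → ℝ}
    {x t : ℝ} {M M' : ℂ → Matrix (Fin 2) (Fin 2) ℂ}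
    (hM : SolvesNSolitonRHP a b α β r N s x t M) (hM' : SolvesNSolitonRHP a b α β r N s x t M') :
    M =ᶠ[cobounded ℂ] M' := by
  filter_upwards [isBounded_def.1 (finite_solitonPoles s).isBounded] with z hz
  exact eq_of_mul_adjugate_eq_one (hM.mul_adjugate hM' z hz) (hM'.mul_adjugate hM' z hz)

theorem continuous_mul_adjugate :
    Continuous fun P : Matrix (Fin 2) (Fin 2) ℂ × Matrix (Fin 2) (Fin 2) ℂ =>
      P.1 * P.2.adjugate := by
  fun_prop

theorem mul_adjugate_jump (A B J : Matrix (Fin 2) (Fin 2) ℂ) (hJ : J.det = 1) :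
    (A * J) * (B * J).adjugate = A * B.adjugate := by
  rw [Matrix.adjugate_mul_distrib, mul_assoc, ← mul_assoc J, Matrix.mul_adjugate, hJ, one_smul,
    one_mul]

theorem isBounded_gasContour (a b ρ : ℝ) :
    IsBounded (Metric.sphere (centre a b) ρ ∪ Metric.sphere (-centre a b) ρ) :=
  Metric.isBounded_sphere.union Metric.isBounded_sphere

/-- Both solutions have the same jump matrix, of determinant one, so it cancels in `M adj(M')`,
whose limits from the two sides of each circle then agree. -/
theorem SolvesGasRHP.mul_adjugate {a b α β ρ : ℝ} {r : ℂ → ℝ} {p : ℝ → ℝ}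
    {x t : ℝ} {M M' : ℂ → Matrix (Fin 2) (Fin 2) ℂ} (hρ : 0 < ρ) (hρ' : ρ < (a + b) / 2)
    (hM : SolvesGasRHP a b α β ρ r p x t M) (hM' : SolvesGasRHP a b α β ρ r p x t M') :
    ∀ z ∈ (Metric.sphere (centre a b) ρ ∪ Metric.sphere (-centre a b) ρ)ᶜ,
      M z * (M' z).adjugate = 1 := by
  have hR : (a + b) / 2 ≤ ‖centre a b‖ := by
    have : ((a : ℂ) + b) / 2 = (((a + b) / 2 : ℝ) : ℂ) := by push_cast; ring
    rw [centre, norm_mul, norm_I, one_mul, this, norm_real]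
    exact le_abs_self _
  have lim : ∀ {F : Filter ℂ} {A B : Matrix (Fin 2) (Fin 2) ℂ}, Tendsto M F (𝓝 A) →
      Tendsto M' F (𝓝 B) → ∀ i j,
      Tendsto (fun z => (M z * (M' z).adjugate) i j) F (𝓝 ((A * B.adjugate) i j)) := by
    intro F A B h1 h2 i j
    have h := (continuous_mul_adjugate.tendsto (A, B)).comp (h1.prodMk_nhds h2)
    exact tendsto_pi_nhds.1 (tendsto_pi_nhds.1 h i) j
  intro z hz
  ext i j
  refine eq_of_circles_removable hρ hρ' hR
    (differentiableOn_mul_adjugate hM.analytic hM'.analytic i j) (fun w hw => ?_)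
    (fun w hw => ?_) (tendsto_mul_adjugate hM.normalized hM'.normalized i j) z hz
  · obtain ⟨A, B, h1, h2, h3⟩ := hM.jump_upper w hw
    obtain ⟨A', B', h1', h2', h3'⟩ := hM'.jump_upper w hw
    refine ⟨_, lim h1 h1' i j, ?_⟩
    rw [h3, h3', mul_adjugate_jump _ _ _ (by simp [Matrix.det_fin_two])]
    exact lim h2 h2' i j
  · obtain ⟨A, B, h1, h2, h3⟩ := hM.jump_lower w hw
    obtain ⟨A', B', h1', h2', h3'⟩ := hM'.jump_lower w hw
    refine ⟨_, lim h2 h2' i j, ?_⟩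
    rw [← mul_adjugate_jump B B' !![1, lowerCauchy a b α β r p x t w; 0, 1]
      (by simp [Matrix.det_fin_two]), ← h3, ← h3']
    exact lim h1 h1' i j

/-- The soliton gas problem has at most one solution off its contour. -/
theorem SolvesGasRHP.unique {a b α β ρ : ℝ} {r : ℂ → ℝ} {p : ℝ → ℝ}
    {x t : ℝ} {M M' : ℂ → Matrix (Fin 2) (Fin 2) ℂ} (hρ : 0 < ρ) (hρ' : ρ < (a + b) / 2)
    (hM : SolvesGasRHP a b α β ρ r p x t M) (hM' : SolvesGasRHP a b α β ρ r p x t M') :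
    M =ᶠ[cobounded ℂ] M' := by
  filter_upwards [isBounded_def.1 (isBounded_gasContour a b ρ)] with z hz
  exact eq_of_mul_adjugate_eq_one (hM.mul_adjugate hρ hρ' hM' z hz)
    (hM'.mul_adjugate hρ hρ' hM' z hz)

theorem RecoveredFrom.congr {M M' : ℂ → Matrix (Fin 2) (Fin 2) ℂ} {q : ℂ}
    (h : RecoveredFrom M q) (hM : M =ᶠ[cobounded ℂ] M') : RecoveredFrom M' q := by
  refine Tendsto.congr' ?_ h
  filter_upwards [hM] with z hz
  rw [hz]

end Uniqueness

/-! ### Cauchy transforms: behaviour at infinity and analyticity -/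

section CauchyTransform

/-- The Cauchy transform `∫ h(y) / (z - J y) dμ(y)`. -/
noncomputable def cauchyTransform (μ : Measure ℝ) (J : ℂ) (h : ℝ → ℂ) (z : ℂ) : ℂ :=
  ∫ y, h y / (z - J * y) ∂μ

theorem tendsto_mul_cauchyTransform {μ : Measure ℝ} {b : ℝ}
    (hμ : ∀ᵐ y ∂μ, |y| ≤ b) {J : ℂ} (hJ : ‖J‖ = 1) {h : ℝ → ℂ} (hh : Integrable h μ) :
    Tendsto (fun z => z * cauchyTransform μ J h z) (cobounded ℂ) (𝓝 (∫ y, h y ∂μ)) := by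
  have hmeas : ∀ z : ℂ, AEStronglyMeasurable (fun y : ℝ => z * (h y / (z - J * y))) μ := by
    intro z
    refine (hh.aestronglyMeasurable.aemeasurable.div ?_).const_mul z |>.aestronglyMeasurable
    fun_prop
  have hlim : ∀ y : ℝ, Tendsto (fun z : ℂ => z * (h y / (z - J * y))) (cobounded ℂ)
      (𝓝 (h y)) := by
    intro y
    have h1 : Tendsto (fun z : ℂ => (1 - J * y * z⁻¹)⁻¹) (cobounded ℂ) (𝓝 1) := by
      have : Tendsto (fun z : ℂ => (1 - J * y * z⁻¹)⁻¹) (cobounded ℂ)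
          (𝓝 (1 - J * y * 0)⁻¹) :=
        ((tendsto_inv₀_cobounded.const_mul (J * (y : ℂ))).const_sub 1).inv₀ (by simp)
      simpa using this
    have h2 := h1.const_mul (h y)
    rw [mul_one] at h2
    refine h2.congr' ?_
    have h3 : ∀ᶠ z : ℂ in cobounded ℂ, z ≠ 0 := eventually_ne_cobounded 0
    filter_upwards [h3] with z hz
    have : z - J * y = z * (1 - J * y * z⁻¹) := by field_simp
    rw [this, div_eq_mul_inv, mul_inv]
    field_simp
  have hcg : (cobounded ℂ).IsCountablyGenerated := by
    rw [← comap_norm_atTop]; infer_instance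
  have := tendsto_integral_filter_of_dominated_convergence (μ := μ) (l := cobounded ℂ)
    (F := fun z y => z * (h y / (z - J * y))) (f := h) (fun y => 2 * ‖h y‖)
    (Eventually.of_forall hmeas) ?_ (hh.norm.const_mul 2) (Eventually.of_forall hlim)
  · refine this.congr fun z => ?_
    rw [integral_const_mul, cauchyTransform]
  · have hbig : ∀ᶠ z : ℂ in cobounded ℂ, 2 * b + 1 ≤ ‖z‖ :=
      tendsto_norm_cobounded_atTop.eventually_ge_atTop _
    filter_upwards [hbig] with z hz
    filter_upwards [hμ] with y hy
    have hb : 0 ≤ b := (abs_nonneg y).trans hy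
    have hz0 : 0 < ‖z‖ := by linarith
    have h1 : ‖z‖ / 2 ≤ ‖z - J * y‖ := by
      have h2 := norm_sub_norm_le z (J * y)
      have h3 : ‖J * (y : ℂ)‖ = |y| := by
        rw [norm_mul, hJ, one_mul, norm_real, Real.norm_eq_abs]
      linarith
    rw [norm_mul, norm_div, ← mul_div_assoc, div_le_iff₀ (by linarith)]
    nlinarith [mul_le_mul_of_nonneg_left h1 (norm_nonneg (h y))]

theorem cauchyTransform_isBigO {μ : Measure ℝ} {b : ℝ}
    (hμ : ∀ᵐ y ∂μ, |y| ≤ b) {J : ℂ} (hJ : ‖J‖ = 1) {h : ℝ → ℂ} (hh : Integrable h μ) :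
    cauchyTransform μ J h =O[cobounded ℂ] (fun z => z⁻¹) := by
  have h1 := (tendsto_mul_cauchyTransform hμ hJ hh).isBigO_one ℂ
  have h2 := (isBigO_refl (fun z : ℂ => z⁻¹) (cobounded ℂ)).mul h1
  refine IsBigO.trans ?_ (h2.trans ?_)
  · refine EventuallyEq.isBigO ?_
    have h3 : ∀ᶠ z : ℂ in cobounded ℂ, z ≠ 0 := eventually_ne_cobounded 0
    filter_upwards [h3] with z hz
    rw [inv_mul_cancel_left₀ hz]
  · refine IsBigO.of_bound 1 (Eventually.of_forall fun z => ?_)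
    simp

theorem exists_le_norm_sub {a b : ℝ} {J z : ℂ} (hz : ∀ y ∈ Set.Icc a b, z ≠ J * y) :
    ∃ δ > 0, ∀ y ∈ Set.Icc a b, ∀ w ∈ Metric.ball z δ, δ ≤ ‖w - J * y‖ := by
  have hK : IsClosed ((fun y : ℝ => J * (y : ℂ)) '' Set.Icc a b) :=
    (isCompact_Icc.image (by fun_prop)).isClosed
  have hz' : z ∈ ((fun y : ℝ => J * (y : ℂ)) '' Set.Icc a b)ᶜ := by
    rintro ⟨y, hy, rfl⟩; exact hz y hy rfl
  obtain ⟨ε, hε, hball⟩ := Metric.isOpen_iff.1 hK.isOpen_compl z hz'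
  refine ⟨ε / 2, half_pos hε, fun y hy w hw => ?_⟩
  by_contra! hlt
  refine hball (a := J * y) ?_ ⟨y, hy, rfl⟩
  rw [Metric.mem_ball] at hw ⊢
  rw [← dist_eq_norm] at hlt
  linarith [dist_triangle_left (J * (y : ℂ)) z w]

theorem aestronglyMeasurable_cauchy {μ : Measure ℝ} {h : ℝ → ℂ} (hh : Integrable h μ) (J z : ℂ) :
    AEStronglyMeasurable (fun y : ℝ => h y / (z - J * y)) μ :=
  (hh.aestronglyMeasurable.aemeasurable.div (by fun_prop)).aestronglyMeasurable

theorem integrable_cauchy {μ : Measure ℝ} {a b : ℝ} (hμ : ∀ᵐ y ∂μ, y ∈ Set.Icc a b) {J : ℂ}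
    {h : ℝ → ℂ} (hh : Integrable h μ) {z : ℂ} (hz : ∀ y ∈ Set.Icc a b, z ≠ J * y) :
    Integrable (fun y : ℝ => h y / (z - J * y)) μ := by
  obtain ⟨δ, hδ, hdist⟩ := exists_le_norm_sub hz
  refine (hh.norm.div_const δ).mono' (aestronglyMeasurable_cauchy hh J z) ?_
  filter_upwards [hμ] with y hy
  rw [norm_div]
  gcongr
  exact hdist y hy z (Metric.mem_ball_self hδ)

theorem differentiableAt_cauchyTransform {μ : Measure ℝ} {a b : ℝ}
    (hμ : ∀ᵐ y ∂μ, y ∈ Set.Icc a b) {J : ℂ} {h : ℝ → ℂ} (hh : Integrable h μ)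
    {z : ℂ} (hz : ∀ y ∈ Set.Icc a b, z ≠ J * y) :
    DifferentiableAt ℂ (cauchyTransform μ J h) z := by
  obtain ⟨δ, hδ, hdist⟩ := exists_le_norm_sub hz
  refine (hasDerivAt_integral_of_dominated_loc_of_deriv_le (μ := μ)
    (F := fun z (y : ℝ) => h y / (z - J * y)) (F' := fun z (y : ℝ) => -h y / (z - J * y) ^ 2)
    (bound := fun y => ‖h y‖ / δ ^ 2)
    (Metric.ball_mem_nhds z hδ) (Eventually.of_forall (aestronglyMeasurable_cauchy hh J))
    (integrable_cauchy hμ hh hz) ?_ ?_ (hh.norm.div_const _) ?_).2.differentiableAt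
  · exact (hh.aestronglyMeasurable.aemeasurable.neg.div (by fun_prop)).aestronglyMeasurable
  · filter_upwards [hμ] with y hy w hw
    rw [norm_div, norm_neg, norm_pow]
    gcongr
    exact hdist y hy w hw
  · filter_upwards [hμ] with y hy w hw
    have hne : w - J * y ≠ 0 := by
      rw [← norm_pos_iff]; exact hδ.trans_le (hdist y hy w hw)
    have := ((hasDerivAt_const w (h y)).div ((hasDerivAt_id w).sub_const (J * (y : ℂ))) hne)
    simp only [zero_mul, mul_one, zero_sub, id] at this
    exact this

end CauchyTransform

/-! ### The integral equations and their contraction -/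

section IntegralEquation

/-- The kernel `1 / (i (s + y))`, cut off at `a`. -/
noncomputable def kernel (a s y : ℝ) : ℂ := (I * ((max s a + max y a : ℝ) : ℂ))⁻¹

/-- The cut-off changes nothing on `[a,b]`, where the measures live. It makes the kernel bounded and
continuous on the whole plane, so that the unknowns can be bounded continuous functions on `ℝ`, a
space common to all the measures. -/
theorem kernel_of_le {a s y : ℝ} (hs : a ≤ s) (hy : a ≤ y) : kernel a s y = (I * (s + y))⁻¹ := by
  rw [kernel, max_eq_left hs, max_eq_left hy]; push_cast; rfl

theorem norm_kernel {a : ℝ} (ha : 0 < a) (s y : ℝ) :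
    ‖kernel a s y‖ = (max s a + max y a)⁻¹ := by
  rw [kernel, norm_inv, norm_mul, norm_I, one_mul, norm_real, Real.norm_of_nonneg]
  linarith [le_max_right s a, le_max_right y a]

theorem norm_kernel_le {a : ℝ} (ha : 0 < a) (s y : ℝ) : ‖kernel a s y‖ ≤ (2 * a)⁻¹ := by
  rw [norm_kernel ha]
  gcongr
  linarith [le_max_right s a, le_max_right y a]

theorem continuous_kernel {a : ℝ} (ha : 0 < a) : Continuous fun q : ℝ × ℝ => kernel a q.1 q.2 := by
  unfold kernel
  refine Continuous.inv₀ (by fun_prop) fun q => mul_ne_zero I_ne_zero ?_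
  rw [ne_eq, ofReal_eq_zero]
  linarith [le_max_right q.1 a, le_max_right q.2 a]

/-- The Lipschitz constant does not depend on `s`; this gives quantile sums against `kernel a s`
that converge uniformly in `s`. -/
theorem norm_kernel_sub_le {a : ℝ} (ha : 0 < a) (s y y' : ℝ) :
    ‖kernel a s y - kernel a s y'‖ ≤ (2 * a)⁻¹ * (2 * a)⁻¹ * |y - y'| := by
  have hne : ∀ y, I * ((max s a + max y a : ℝ) : ℂ) ≠ 0 := fun y => by
    refine mul_ne_zero I_ne_zero ?_
    rw [ne_eq, ofReal_eq_zero]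
    linarith [le_max_right s a, le_max_right y a]
  have h1 : kernel a s y - kernel a s y' =
      kernel a s y * kernel a s y' * (I * ((max y' a - max y a : ℝ) : ℂ)) := by
    rw [kernel, kernel, inv_sub_inv (hne y) (hne y'), div_eq_mul_inv, mul_inv]
    push_cast; ring
  rw [h1, norm_mul, norm_mul, norm_mul, norm_I, one_mul, norm_real, Real.norm_eq_abs, abs_sub_comm]
  refine mul_le_mul (mul_le_mul (norm_kernel_le ha s y) (norm_kernel_le ha s y') (norm_nonneg _)
    (by positivity)) ?_ (abs_nonneg _) (by positivity)
  · exact abs_max_sub_max_le_abs y y' a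

theorem integrable_mul_bcf {μ : Measure ℝ} {w : ℝ → ℂ} (hw : Integrable w μ)
    (f : BoundedContinuousFunction ℝ ℂ) : Integrable (fun y => w y * f y) μ :=
  hw.mul_bdd (c := ‖f‖) f.continuous.aestronglyMeasurable
    (Eventually.of_forall fun y => f.norm_coe_le_norm y)

theorem norm_integral_mul_bcf_le {μ : Measure ℝ} {w : ℝ → ℂ} (hw : Integrable w μ)
    (f : BoundedContinuousFunction ℝ ℂ) : ‖∫ y, w y * f y ∂μ‖ ≤ (∫ y, ‖w y‖ ∂μ) * ‖f‖ := by
  rw [← integral_mul_const]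
  refine norm_integral_le_of_norm_le (hw.norm.mul_const _) (Eventually.of_forall fun y => ?_)
  rw [norm_mul]
  gcongr
  exact f.norm_coe_le_norm y

theorem integrable_mul_kernel {a : ℝ} (ha : 0 < a) {μ : Measure ℝ} {w : ℝ → ℂ}
    (hw : Integrable w μ) (s : ℝ) : Integrable (fun y => w y * kernel a s y) μ :=
  hw.mul_bdd (c := (2 * a)⁻¹)
    ((continuous_kernel ha).comp (by fun_prop : Continuous fun y : ℝ => (s, y))).aestronglyMeasurable
    (Eventually.of_forall fun y => norm_kernel_le ha s y)

theorem continuous_integral_kernel {a : ℝ} (ha : 0 < a) {μ : Measure ℝ} {w : ℝ → ℂ}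
    (hw : Integrable w μ) : Continuous fun s => ∫ y, w y * kernel a s y ∂μ := by
  refine continuous_of_dominated (bound := fun y => ‖w y‖ * (2 * a)⁻¹)
    (fun s => (integrable_mul_kernel ha hw s).aestronglyMeasurable) (fun s => ?_)
    (hw.norm.mul_const _) (Eventually.of_forall fun y => ?_)
  · refine Eventually.of_forall fun y => ?_
    rw [norm_mul]
    gcongr
    exact norm_kernel_le ha s y
  · exact ((continuous_kernel ha).comp (by fun_prop : Continuous fun s : ℝ => (s, y))).const_mul _

theorem norm_integral_kernel_le {a : ℝ} (ha : 0 < a) {μ : Measure ℝ} {w : ℝ → ℂ}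
    (hw : Integrable w μ) (s : ℝ) :
    ‖∫ y, w y * kernel a s y ∂μ‖ ≤ (∫ y, ‖w y‖ ∂μ) * (2 * a)⁻¹ := by
  rw [← integral_mul_const]
  refine norm_integral_le_of_norm_le (hw.norm.mul_const _) (Eventually.of_forall fun y => ?_)
  rw [norm_mul]
  gcongr
  exact norm_kernel_le ha s y

/-- The function `s ↦ ∫ w(y) / (i (s + y)) dμ(y)`. -/
noncomputable def kernelTransform {a : ℝ} (ha : 0 < a) {μ : Measure ℝ} {w : ℝ → ℂ}
    (hw : Integrable w μ) : BoundedContinuousFunction ℝ ℂ :=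
  BoundedContinuousFunction.ofNormedAddCommGroup (fun s => ∫ y, w y * kernel a s y ∂μ)
    (continuous_integral_kernel ha hw) _ (norm_integral_kernel_le ha hw)

@[simp]
theorem kernelTransform_apply {a : ℝ} (ha : 0 < a) {μ : Measure ℝ} {w : ℝ → ℂ}
    (hw : Integrable w μ) (s : ℝ) : kernelTransform ha hw s = ∫ y, w y * kernel a s y ∂μ := rfl

/-- Mass at most `a` times kernel at most `1 / (2a)` gives the ratio `1/2`. -/
theorem dist_kernelTransform_le {a : ℝ} (ha : 0 < a) {μ : Measure ℝ} {w : ℝ → ℂ}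
    (hw : Integrable w μ) (hsmall : ∫ y, ‖w y‖ ∂μ ≤ a) (f g : BoundedContinuousFunction ℝ ℂ) :
    dist (kernelTransform ha (integrable_mul_bcf hw f))
      (kernelTransform ha (integrable_mul_bcf hw g)) ≤ 1 / 2 * dist f g := by
  rw [BoundedContinuousFunction.dist_le (by positivity)]
  intro s
  have hmul : ∀ y, w y * f y * kernel a s y - w y * g y * kernel a s y =
      w y * kernel a s y * (f - g) y := fun y => by
    rw [BoundedContinuousFunction.sub_apply]; ring
  rw [dist_eq_norm, kernelTransform_apply, kernelTransform_apply, ← integral_sub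
    (integrable_mul_kernel ha (integrable_mul_bcf hw f) s)
    (integrable_mul_kernel ha (integrable_mul_bcf hw g) s)]
  simp_rw [hmul]
  refine (norm_integral_mul_bcf_le (integrable_mul_kernel ha hw s) _).trans ?_
  rw [dist_eq_norm]
  gcongr
  calc ∫ y, ‖w y * kernel a s y‖ ∂μ ≤ ∫ y, ‖w y‖ * (2 * a)⁻¹ ∂μ := by
        refine integral_mono (integrable_mul_kernel ha hw s).norm (hw.norm.mul_const _) fun y => ?_
        simp only [norm_mul]
        gcongr
        exact norm_kernel_le ha s y
    _ = (∫ y, ‖w y‖ ∂μ) * (2 * a)⁻¹ := integral_mul_const _ _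
    _ ≤ a * (2 * a)⁻¹ := by gcongr
    _ = 1 / 2 := by field_simp

/-- Densities of the jump data which are small enough for the integral equations to be
contractive. -/
structure SmallData (a : ℝ) (μ : Measure ℝ) (wp wm : ℝ → ℂ) : Prop where
  pos : 0 < a
  integrable_upper : Integrable wp μ
  integrable_lower : Integrable wm μ
  upper_le : ∫ y, ‖wp y‖ ∂μ ≤ a
  lower_le : ∫ y, ‖wm y‖ ∂μ ≤ a

namespace SmallData

variable {a : ℝ} {μ : Measure ℝ} {wp wm : ℝ → ℂ} (h : SmallData a μ wp wm)

/-- The right-hand side of the integral equations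
`f(s) = c - ∫ wp(y) g(y) / (i (s + y)) dμ(y)`, `g(s) = d + ∫ wm(y) f(y) / (i (s + y)) dμ(y)`. -/
noncomputable def rhs (h : SmallData a μ wp wm) (c d : ℂ)
    (u : BoundedContinuousFunction ℝ ℂ × BoundedContinuousFunction ℝ ℂ) :
    BoundedContinuousFunction ℝ ℂ × BoundedContinuousFunction ℝ ℂ :=
  (BoundedContinuousFunction.const ℝ c -
      kernelTransform h.pos (integrable_mul_bcf h.integrable_upper u.2),
    BoundedContinuousFunction.const ℝ d +
      kernelTransform h.pos (integrable_mul_bcf h.integrable_lower u.1))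

theorem contracting (c d : ℂ) : ContractingWith (1 / 2) (h.rhs c d) := by
  refine ⟨NNReal.half_lt_self one_ne_zero, LipschitzWith.of_dist_le_mul fun u v => ?_⟩
  rw [Prod.dist_eq, Prod.dist_eq]
  simp only [rhs, dist_sub_left, dist_add_left]
  push_cast
  refine max_le ?_ ?_
  · refine (dist_kernelTransform_le h.pos h.integrable_upper h.upper_le u.2 v.2).trans ?_
    gcongr
    exact le_max_right _ _
  · refine (dist_kernelTransform_le h.pos h.integrable_lower h.lower_le u.1 v.1).trans ?_
    gcongr
    exact le_max_left _ _

/-- The solution of the integral equations. -/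
noncomputable def solution (h : SmallData a μ wp wm) (c d : ℂ) :
    BoundedContinuousFunction ℝ ℂ × BoundedContinuousFunction ℝ ℂ :=
  ContractingWith.fixedPoint (h.rhs c d) (h.contracting c d)

theorem rhs_solution (c d : ℂ) : h.rhs c d (h.solution c d) = h.solution c d :=
  (h.contracting c d).fixedPoint_isFixedPt

theorem solution_fst (c d : ℂ) (s : ℝ) : (h.solution c d).1 s =
    c - ∫ y, wp y * (h.solution c d).2 y * kernel a s y ∂μ := by
  conv_lhs => rw [← h.rhs_solution c d]
  rfl

theorem solution_snd (c d : ℂ) (s : ℝ) : (h.solution c d).2 s =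
    d + ∫ y, wm y * (h.solution c d).1 y * kernel a s y ∂μ := by
  conv_lhs => rw [← h.rhs_solution c d]
  rfl

theorem dist_solution_le (c d : ℂ)
    (u : BoundedContinuousFunction ℝ ℂ × BoundedContinuousFunction ℝ ℂ) :
    dist u (h.solution c d) ≤ 2 * dist u (h.rhs c d u) := by
  refine ((h.contracting c d).dist_fixedPoint_le u).trans (le_of_eq ?_)
  push_cast
  ring

/-- The a posteriori estimate at the zero function, which `rhs` sends to the constant pair `(1, 0)`.
-/
theorem norm_solution_le : ‖h.solution 1 0‖ ≤ 2 := by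
  have h1 := h.dist_solution_le 1 0 0
  rw [dist_zero_left] at h1
  refine h1.trans ?_
  have h2 : ∀ c, h.rhs c 0 0 = (BoundedContinuousFunction.const ℝ c, 0) := by
    intro c
    refine Prod.ext ?_ ?_ <;> ext s <;> simp [rhs]
  rw [h2, dist_zero_left, Prod.norm_mk]
  have : ‖BoundedContinuousFunction.const ℝ (1 : ℂ)‖ ≤ 1 :=
    (BoundedContinuousFunction.norm_const_le _).trans (by simp)
  simp only [norm_zero]
  linarith [max_le this zero_le_one]

end SmallData

end IntegralEquation

/-! ### Columns and potential built from the integral equations -/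

section Dressing

variable {a : ℝ} {μ : Measure ℝ} {wp wm : ℝ → ℂ}

namespace SmallData

/-- The first column densities of row `i`. -/
noncomputable def rowSolution (h : SmallData a μ wp wm) (i : Fin 2) :
    BoundedContinuousFunction ℝ ℂ × BoundedContinuousFunction ℝ ℂ :=
  h.solution ((1 : Matrix (Fin 2) (Fin 2) ℂ) i 0) ((1 : Matrix (Fin 2) (Fin 2) ℂ) i 1)

/-- The first column of the dressing matrix. -/
noncomputable def firstCol (h : SmallData a μ wp wm) (i : Fin 2) (z : ℂ) : ℂ :=
  (1 : Matrix (Fin 2) (Fin 2) ℂ) i 0 +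
    cauchyTransform μ I (fun y => wp y * (h.rowSolution i).2 y) z

/-- The second column of the dressing matrix. -/
noncomputable def secondCol (h : SmallData a μ wp wm) (i : Fin 2) (z : ℂ) : ℂ :=
  (1 : Matrix (Fin 2) (Fin 2) ℂ) i 1 +
    cauchyTransform μ (-I) (fun y => wm y * (h.rowSolution i).1 y) z

/-- The potential `2 i ∫ wm f dμ`. -/
noncomputable def potential (h : SmallData a μ wp wm) : ℂ :=
  2 * I * ∫ y, wm y * (h.solution 1 0).1 y ∂μ

theorem norm_potential_le (h : SmallData a μ wp wm) :
    ‖h.potential‖ ≤ 4 * ∫ y, ‖wm y‖ ∂μ := by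
  have h1 := norm_integral_mul_bcf_le h.integrable_lower (h.solution 1 0).1
  have h2 : ‖(h.solution 1 0).1‖ ≤ 2 := (norm_fst_le _).trans h.norm_solution_le
  have h3 : 0 ≤ ∫ y, ‖wm y‖ ∂μ := integral_nonneg fun y => norm_nonneg _
  rw [potential, norm_mul, norm_mul, norm_I, Complex.norm_two, mul_one]
  nlinarith [mul_le_mul_of_nonneg_left h2 h3]

theorem normalized_of_eq {b : ℝ} (h : SmallData a μ wp wm) (hμ : ∀ᵐ y ∂μ, |y| ≤ b)
    {M : ℂ → Matrix (Fin 2) (Fin 2) ℂ}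
    (hM : ∀ᶠ z in cobounded ℂ, ∀ i, M z i 0 = h.firstCol i z ∧ M z i 1 = h.secondCol i z) :
    Normalized M := by
  intro i j
  fin_cases j
  · refine IsBigO.congr' (cauchyTransform_isBigO hμ norm_I
      (integrable_mul_bcf h.integrable_upper (h.rowSolution i).2)) ?_ EventuallyEq.rfl
    filter_upwards [hM] with z hz
    exact ((sub_eq_iff_eq_add'.2 ((hz i).1.trans rfl)).symm)
  · refine IsBigO.congr' (cauchyTransform_isBigO hμ (by simp : ‖-I‖ = 1)
      (integrable_mul_bcf h.integrable_lower (h.rowSolution i).1)) ?_ EventuallyEq.rfl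
    filter_upwards [hM] with z hz
    exact ((sub_eq_iff_eq_add'.2 ((hz i).2.trans rfl)).symm)

theorem recoveredFrom_of_eq {b : ℝ} (h : SmallData a μ wp wm) (hμ : ∀ᵐ y ∂μ, |y| ≤ b)
    {M : ℂ → Matrix (Fin 2) (Fin 2) ℂ}
    (hM : ∀ᶠ z in cobounded ℂ, ∀ i, M z i 0 = h.firstCol i z ∧ M z i 1 = h.secondCol i z) :
    RecoveredFrom M h.potential := by
  have h1 := (tendsto_mul_cauchyTransform hμ (by simp : ‖-I‖ = 1)
    (integrable_mul_bcf h.integrable_lower (h.rowSolution 0).1)).const_mul (2 * I)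
  have h2 : h.rowSolution 0 = h.solution 1 0 := by simp [rowSolution]
  rw [h2] at h1
  refine h1.congr' ?_
  filter_upwards [hM] with z hz
  simp [(hz 0).2, secondCol, h2]

end SmallData

end Dressing

/-! ### Solution of the pure-soliton problem -/

section NSoliton

/-- The counting measure of the points `s_j`. -/
noncomputable def solitonMeasure {N : ℕ} (s : Fin N → ℝ) : Measure ℝ :=
  ∑ j, Measure.dirac (s j)

theorem integrable_solitonMeasure {E : Type*} [NormedAddCommGroup E] {N : ℕ} (s : Fin N → ℝ)
    (h : ℝ → E) : Integrable h (solitonMeasure s) :=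
  integrable_finsetSum_measure.2 fun _ _ => integrable_dirac enorm_lt_top

theorem integral_solitonMeasure {E : Type*} [NormedAddCommGroup E] [NormedSpace ℝ E]
    [CompleteSpace E] {N : ℕ} (s : Fin N → ℝ)
    (h : ℝ → E) : ∫ y, h y ∂(solitonMeasure s) = ∑ j, h (s j) := by
  rw [solitonMeasure, integral_finsetSum_measure fun _ _ => integrable_dirac enorm_lt_top]
  simp

theorem ae_solitonMeasure {N : ℕ} {s : Fin N → ℝ} {a b : ℝ} (hs : ∀ j, s j ∈ Set.Icc a b) :
    ∀ᵐ y ∂(solitonMeasure s), y ∈ Set.Icc a b := by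
  rw [solitonMeasure, ← Measure.sum_fintype, Measure.ae_sum_iff]
  intro j
  exact (ae_dirac_iff (p := fun y => y ∈ Set.Icc a b) measurableSet_Icc).2 (hs j)

theorem abs_le_of_mem_Icc {a b y : ℝ} (ha : 0 < a) (hy : y ∈ Set.Icc a b) : |y| ≤ b := by
  rw [abs_of_pos (ha.trans_le hy.1)]; exact hy.2

theorem cauchyTransform_solitonMeasure {N : ℕ} (s : Fin N → ℝ) (J : ℂ) (h : ℝ → ℂ) (z : ℂ) :
    cauchyTransform (solitonMeasure s) J h z = ∑ j, h (s j) / (z - J * s j) :=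
  integral_solitonMeasure s _

theorem differentiableAt_cauchyTransform_solitonMeasure {N : ℕ} {s : Fin N → ℝ} {J : ℂ}
    {h : ℝ → ℂ} {z : ℂ} (hz : ∀ j, z ≠ J * s j) :
    DifferentiableAt ℂ (cauchyTransform (solitonMeasure s) J h) z := by
  have : cauchyTransform (solitonMeasure s) J h = fun z => ∑ j, h (s j) / (z - J * s j) :=
    funext fun z => cauchyTransform_solitonMeasure s J h z
  rw [this]
  refine DifferentiableAt.fun_sum fun j _ => ?_
  exact (differentiableAt_const _).div (by fun_prop) (sub_ne_zero.2 (hz j))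

theorem tendsto_residue_solitonMeasure {N : ℕ} {s : Fin N → ℝ} (hs : Function.Injective s)
    {J : ℂ} (hJ : J ≠ 0) (h : ℝ → ℂ) (k : Fin N) :
    Tendsto (fun z => (z - J * s k) * cauchyTransform (solitonMeasure s) J h z)
      (𝓝[≠] (J * s k)) (𝓝 (h (s k))) := by
  have hterm : ∀ j, Tendsto (fun z => (z - J * s k) * (h (s j) / (z - J * s j)))
      (𝓝[≠] (J * s k)) (𝓝 (if j = k then h (s k) else 0)) := by
    intro j
    by_cases hjk : j = k
    · subst hjk
      rw [if_pos rfl]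
      refine tendsto_const_nhds.congr' ?_
      filter_upwards [self_mem_nhdsWithin] with z hz
      rw [mul_div_cancel₀ _ (sub_ne_zero.2 hz)]
    · rw [if_neg hjk]
      have hne : J * (s k : ℂ) - J * s j ≠ 0 := by
        rw [← mul_sub]
        refine mul_ne_zero hJ (sub_ne_zero.2 ?_)
        exact_mod_cast fun h => hjk (hs h).symm
      have hc : ContinuousAt (fun z => (z - J * s k) * (h (s j) / (z - J * s j))) (J * s k) :=
        (by fun_prop : ContinuousAt (fun z => z - J * s k) (J * s k)).mul
          (continuousAt_const.div (by fun_prop) hne)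
      have := hc.tendsto
      rw [sub_self, zero_mul] at this
      exact this.mono_left nhdsWithin_le_nhds
  have := tendsto_finsetSum Finset.univ fun j _ => hterm j
  simp only [Finset.sum_ite_eq', Finset.mem_univ, if_true] at this
  refine this.congr fun z => ?_
  rw [cauchyTransform_solitonMeasure, Finset.mul_sum]

variable {a b α β : ℝ} {r : ℂ → ℝ} {N : ℕ} {s : Fin N → ℝ} {x t : ℝ}

/-- Smallness of the residue data of the `N`-soliton. -/
abbrev SolitonData (a b α β : ℝ) (r : ℂ → ℝ) (N : ℕ) (s : Fin N → ℝ) (x t : ℝ) : Prop :=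
  SmallData a (solitonMeasure s) (upperCoeff a b α β r N x t) (lowerCoeff a b α β r N x t)

/-- The solution of the pure-soliton problem. -/
noncomputable def solitonMatrix (h : SolitonData a b α β r N s x t) (z : ℂ) :
    Matrix (Fin 2) (Fin 2) ℂ :=
  Matrix.of fun i => ![h.firstCol i z, h.secondCol i z]

theorem mul_I_ne_neg {y y' : ℝ} (hy : 0 < y) (hy' : 0 < y') : I * (y : ℂ) ≠ -(I * y') := by
  intro h
  have := congrArg Complex.im h
  simp at this
  linarith

/-- This is where the integral equation enters: its unknown is the value of the regular column at
the pole, as the residue condition demands. -/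
theorem secondCol_at_pole (h : SolitonData a b α β r N s x t) (hs : ∀ j, s j ∈ Set.Icc a b)
    (i : Fin 2) (k : Fin N) : h.secondCol i (I * s k) = (h.rowSolution i).2 (s k) := by
  rw [SmallData.secondCol, SmallData.rowSolution, SmallData.solution_snd,
    cauchyTransform_solitonMeasure, integral_solitonMeasure]
  congr 1
  refine Finset.sum_congr rfl fun j _ => ?_
  rw [kernel_of_le (hs k).1 (hs j).1, div_eq_mul_inv]
  congr 2; ring

theorem firstCol_at_pole (h : SolitonData a b α β r N s x t) (hs : ∀ j, s j ∈ Set.Icc a b)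
    (i : Fin 2) (k : Fin N) : h.firstCol i (-(I * s k)) = (h.rowSolution i).1 (s k) := by
  rw [SmallData.firstCol, SmallData.rowSolution, SmallData.solution_fst,
    cauchyTransform_solitonMeasure, integral_solitonMeasure, sub_eq_add_neg,
    ← Finset.sum_neg_distrib]
  congr 1
  refine Finset.sum_congr rfl fun j _ => ?_
  rw [kernel_of_le (hs k).1 (hs j).1, div_eq_mul_inv,
    show -(I * (s k : ℂ)) - I * s j = -(I * (s k + s j)) by ring, inv_neg, mul_neg]

theorem differentiableAt_firstCol_soliton (h : SolitonData a b α β r N s x t) (i : Fin 2) {z : ℂ}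
    (hz : ∀ k, z ≠ I * s k) : DifferentiableAt ℂ (h.firstCol i) z :=
  (differentiableAt_cauchyTransform_solitonMeasure hz).const_add _

theorem differentiableAt_secondCol_soliton (h : SolitonData a b α β r N s x t) (i : Fin 2) {z : ℂ}
    (hz : ∀ k, z ≠ -(I * s k)) : DifferentiableAt ℂ (h.secondCol i) z :=
  (differentiableAt_cauchyTransform_solitonMeasure fun k => by
    rw [neg_mul]; exact hz k).const_add _

theorem tendsto_sub_mul_const_add {F : ℂ → ℂ} {w l : ℂ} (e : ℂ)
    (h : Tendsto (fun z => (z - w) * F z) (𝓝[≠] w) (𝓝 l)) :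
    Tendsto (fun z => (z - w) * (e + F z)) (𝓝[≠] w) (𝓝 l) := by
  have h1 : Tendsto (fun z => (z - w) * e) (𝓝[≠] w) (𝓝 0) := by
    have : Tendsto (fun z => (z - w) * e) (𝓝 w) (𝓝 ((w - w) * e)) :=
      Continuous.tendsto (by fun_prop) w
    rw [sub_self, zero_mul] at this
    exact this.mono_left nhdsWithin_le_nhds
  have := h1.add h
  rw [zero_add] at this
  exact this.congr fun z => by ring

theorem tendsto_sub_mul_of_continuousAt {F : ℂ → ℂ} {w : ℂ} (h : ContinuousAt F w) :
    Tendsto (fun z => (z - w) * F z) (𝓝[≠] w) (𝓝 0) := by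
  have h1 : ContinuousAt (fun z => (z - w) * F z) w :=
    (by fun_prop : ContinuousAt (fun z => z - w) w).mul h
  have := h1.tendsto
  rw [sub_self, zero_mul] at this
  exact this.mono_left nhdsWithin_le_nhds

/-- Distinct `s_j` make each residue a single term of the sum. Since all `s_j` are positive, the
poles of one column are regular points of the other. -/
theorem solves_solitonMatrix (ha : 0 < a) (h : SolitonData a b α β r N s x t)
    (hs : ∀ j, s j ∈ Set.Icc a b) (hinj : Function.Injective s) :
    SolvesNSolitonRHP a b α β r N s x t (solitonMatrix h) where
  analytic i j := by
    intro z hz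
    refine DifferentiableAt.differentiableWithinAt ?_
    fin_cases j
    · exact differentiableAt_firstCol_soliton h i fun k => (hz k).1
    · exact differentiableAt_secondCol_soliton h i fun k => (hz k).2
  normalized := h.normalized_of_eq
    ((ae_solitonMeasure hs).mono fun y hy => abs_le_of_mem_Icc ha hy)
    (Eventually.of_forall fun z i => ⟨rfl, rfl⟩)
  residue_upper k := by
    have hpos : ∀ j, 0 < s j := fun j => ha.trans_le (hs j).1
    have hcont : ∀ i, ContinuousAt (h.secondCol i) (I * s k) := fun i =>
      (differentiableAt_secondCol_soliton h i fun j => mul_I_ne_neg (hpos k) (hpos j)).continuousAt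
    refine ⟨Matrix.of fun i => ![upperCoeff a b α β r N x t (s k) * (h.rowSolution i).2 (s k), 0],
      ?_, ?_⟩
    · refine tendsto_pi_nhds.2 fun i => tendsto_pi_nhds.2 fun j => ?_
      fin_cases j
      · have := ((hcont i).tendsto.mono_left nhdsWithin_le_nhds :
          Tendsto _ (𝓝[≠] (I * (s k : ℂ))) _).const_mul (upperCoeff a b α β r N x t (s k))
        rw [secondCol_at_pole h hs] at this
        simpa [Matrix.mul_apply, Fin.sum_univ_two, solitonMatrix, mul_comm] using this
      · simp [Matrix.mul_apply, Fin.sum_univ_two]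
    · refine tendsto_pi_nhds.2 fun i => tendsto_pi_nhds.2 fun j => ?_
      fin_cases j
      · exact tendsto_sub_mul_const_add _ (tendsto_residue_solitonMeasure hinj I_ne_zero _ k)
      · exact tendsto_sub_mul_of_continuousAt (hcont i)
  residue_lower k := by
    have hpos : ∀ j, 0 < s j := fun j => ha.trans_le (hs j).1
    have hcont : ∀ i, ContinuousAt (h.firstCol i) (-(I * s k)) := fun i =>
      (differentiableAt_firstCol_soliton h i fun j =>
        (mul_I_ne_neg (hpos j) (hpos k)).symm).continuousAt
    refine ⟨Matrix.of fun i => ![0, lowerCoeff a b α β r N x t (s k) * (h.rowSolution i).1 (s k)],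
      ?_, ?_⟩
    · refine tendsto_pi_nhds.2 fun i => tendsto_pi_nhds.2 fun j => ?_
      fin_cases j
      · simp [Matrix.mul_apply, Fin.sum_univ_two]
      · have := ((hcont i).tendsto.mono_left nhdsWithin_le_nhds :
          Tendsto _ (𝓝[≠] (-(I * (s k : ℂ)))) _).const_mul (lowerCoeff a b α β r N x t (s k))
        rw [firstCol_at_pole h hs] at this
        simpa [Matrix.mul_apply, Fin.sum_univ_two, solitonMatrix, mul_comm] using this
    · refine tendsto_pi_nhds.2 fun i => tendsto_pi_nhds.2 fun j => ?_
      fin_cases j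
      · exact tendsto_sub_mul_of_continuousAt (hcont i)
      · have := tendsto_residue_solitonMeasure hinj (neg_ne_zero.2 I_ne_zero)
          (fun y => lowerCoeff a b α β r N x t y * (h.rowSolution i).1 y) k
        rw [neg_mul] at this
        exact tendsto_sub_mul_const_add _ this

/-- With small data, the potential of the integral equations is the `N`-soliton potential. -/
theorem isNSolitonPotential (ha : 0 < a) (h : SolitonData a b α β r N s x t)
    (hs : ∀ j, s j ∈ Set.Icc a b) (hinj : Function.Injective s) :
    IsNSolitonPotential a b α β r N s x t h.potential := by
  refine ⟨⟨_, solves_solitonMatrix ha h hs hinj⟩, fun M hM => ?_⟩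
  have h1 : RecoveredFrom (solitonMatrix h) h.potential := h.recoveredFrom_of_eq
    ((ae_solitonMeasure hs).mono fun y hy => abs_le_of_mem_Icc ha hy)
    (Eventually.of_forall fun z i => ⟨rfl, rfl⟩)
  exact h1.congr ((solves_solitonMatrix ha h hs hinj).unique hM)

end NSoliton

/-! ### Cancellation of the cut by partial fractions -/

section CauchyProduct

theorem kernel_comm (a s y : ℝ) : kernel a s y = kernel a y s := by
  rw [kernel, kernel, add_comm]

/-- The product of the Cauchy transforms of the two columns, with the integral equation used to
remove the singularities of one of them. -/
theorem cauchyTransform_sub_mul {a b : ℝ} (ha : 0 < a) {μ : Measure ℝ} [SFinite μ]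
    (hμ : ∀ᵐ y ∂μ, y ∈ Set.Icc a b) {σ : ℂ} (hσ : σ * σ = 1) {w v : ℝ → ℂ} (hw : Integrable w μ)
    (hv : Integrable v μ) (f g : BoundedContinuousFunction ℝ ℂ) (d : ℂ)
    (hg : ∀ s, g s = d + σ * ∫ y, v y * f y * kernel a s y ∂μ) {z : ℂ}
    (hz : ∀ y ∈ Set.Icc a b, z ≠ σ * I * y) (hz' : ∀ y ∈ Set.Icc a b, z ≠ -(σ * I) * y) :
    cauchyTransform μ (σ * I) (fun y => w y * g y) z -
        cauchyTransform μ (σ * I) w z *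
          (d + cauchyTransform μ (-(σ * I)) (fun y => v y * f y) z) =
      σ * cauchyTransform μ (-(σ * I)) (fun y => v y * f y * kernelTransform ha hw y) z := by
  have hvf := integrable_mul_bcf hv f
  have hA := integrable_cauchy hμ hw hz
  have hAg := integrable_cauchy hμ (integrable_mul_bcf hw g) hz
  have hB := integrable_cauchy hμ hvf hz'
  set B : ℂ := cauchyTransform μ (-(σ * I)) (fun y => v y * f y) z with hBdef
  have h1 : cauchyTransform μ (σ * I) (fun y => w y * g y) z -
      cauchyTransform μ (σ * I) w z * (d + B) =
      ∫ y, w y / (z - σ * I * y) * (g y - (d + B)) ∂μ := by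
    rw [cauchyTransform, cauchyTransform, ← integral_mul_const, ← integral_sub hAg
      (hA.mul_const _)]
    refine integral_congr_ae (Eventually.of_forall fun y => ?_)
    simp only
    ring
  -- The bracket `g y - (d + B)` compares the Cauchy integral at `σ I y` with the one at `z`, hence
  -- contains the factor `z - σ I y`. This cancels the denominator in front, leaving no singularity
  -- on `σ i[a,b]`.
  have h2 : ∀ᵐ y ∂μ, w y / (z - σ * I * y) * (g y - (d + B)) =
      ∫ y', σ * (w y * (v y' * f y' / (z - -(σ * I) * y')) * kernel a y y') ∂μ := by
    filter_upwards [hμ] with y hy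
    rw [hg, hBdef, cauchyTransform, add_sub_add_left_eq_sub, ← integral_const_mul, ← integral_sub
      ((integrable_mul_kernel ha hvf y).const_mul σ) hB, ← integral_const_mul]
    refine integral_congr_ae ?_
    filter_upwards [hμ] with y' hy'
    have e1 : z - σ * I * y ≠ 0 := sub_ne_zero.2 (hz y hy)
    have e2 : z - -(σ * I) * y' ≠ 0 := sub_ne_zero.2 (hz' y' hy')
    have e3 : (y : ℂ) + y' ≠ 0 := by
      have h0 : 0 < y + y' := add_pos (ha.trans_le hy.1) (ha.trans_le hy'.1)
      exact_mod_cast h0.ne'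
    have e4 : I * ((y : ℂ) + y') ≠ 0 := mul_ne_zero I_ne_zero e3
    rw [kernel_of_le hy.1 hy'.1]
    have e5 : σ * (I * ((y : ℂ) + y'))⁻¹ - 1 / (z - -(σ * I) * y') =
        σ * (I * ((y : ℂ) + y'))⁻¹ * (z - σ * I * y) / (z - -(σ * I) * y') := by
      have e6 : z - σ * I * y = z - -(σ * I) * y' - σ * (I * ((y : ℂ) + y')) := by ring
      rw [e6]
      generalize z - -(σ * I) * y' = D at e2
      generalize I * ((y : ℂ) + y') = k at e4
      field_simp
      linear_combination k * hσ
    have e6 : σ * (v y' * f y' * (I * ((y : ℂ) + y'))⁻¹) - v y' * f y' / (z - -(σ * I) * y') =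
        v y' * f y' * (σ * (I * ((y : ℂ) + y'))⁻¹ - 1 / (z - -(σ * I) * y')) := by ring
    rw [e6, e5]
    field_simp
  have h3 : Integrable (Function.uncurry fun y y' : ℝ =>
      σ * (w y * (v y' * f y' / (z - -(σ * I) * y')) * kernel a y y')) (μ.prod μ) := by
    refine Integrable.const_mul ?_ σ
    exact (hw.mul_prod hB).mul_bdd (c := (2 * a)⁻¹)
      (continuous_kernel ha).aestronglyMeasurable
      (Eventually.of_forall fun y => norm_kernel_le ha y.1 y.2)
  -- After exchanging the integrals, the inner one over `y` is `kernelTransform` of `w`, by symmetry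
  -- of the kernel.
  rw [h1, integral_congr_ae h2, integral_integral_swap h3, cauchyTransform, ← integral_const_mul]
  refine integral_congr_ae (Eventually.of_forall fun y' => ?_)
  simp only [kernelTransform_apply]
  have e : ∀ X, σ * (v y' * f y' * X / (z - -(σ * I) * y')) =
      σ * (v y' * f y' / (z - -(σ * I) * y')) * X := fun X => by ring
  rw [e, ← integral_const_mul]
  refine integral_congr_ae (Eventually.of_forall fun y => ?_)
  simp only [kernel_comm a y y']
  ring

end CauchyProduct

/-! ### Solution of the soliton gas problem -/

section Gas

/-- The density on `[a,b]` whose Cauchy transform is `upperCauchy`. -/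
noncomputable def upperWeight (a b α β : ℝ) (r : ℂ → ℝ) (p : ℝ → ℝ) (x t s : ℝ) : ℂ :=
  I * (b - a) * r (I * s) * p s / Real.pi * exp (2 * I * phase α β x t (I * s))

/-- The density on `[a,b]` whose Cauchy transform is `lowerCauchy`. -/
noncomputable def lowerWeight (a b α β : ℝ) (r : ℂ → ℝ) (p : ℝ → ℝ) (x t s : ℝ) : ℂ :=
  I * (b - a) * r (-(I * s)) * p s / Real.pi * exp (-(2 * I * phase α β x t (-(I * s))))

variable {a b α β ρ : ℝ} {r : ℂ → ℝ} {p : ℝ → ℝ} {x t : ℝ}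

theorem upperCauchy_eq (hab : a ≤ b) (z : ℂ) : upperCauchy a b α β r p x t z =
    cauchyTransform (volume.restrict (Set.Ioc a b)) I (upperWeight a b α β r p x t) z := by
  rw [upperCauchy, intervalIntegral.integral_of_le hab]; rfl

theorem lowerCauchy_eq (hab : a ≤ b) (z : ℂ) : lowerCauchy a b α β r p x t z =
    cauchyTransform (volume.restrict (Set.Ioc a b)) (-I) (lowerWeight a b α β r p x t) z := by
  rw [lowerCauchy, intervalIntegral.integral_of_le hab, cauchyTransform]
  simp only [neg_mul]; rfl

/-- Smallness of the jump data of the soliton gas. -/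
abbrev GasData (a b α β : ℝ) (r : ℂ → ℝ) (p : ℝ → ℝ) (x t : ℝ) : Prop :=
  SmallData a (volume.restrict (Set.Ioc a b)) (upperWeight a b α β r p x t)
    (lowerWeight a b α β r p x t)

theorem ae_mem_Icc (a b : ℝ) : ∀ᵐ y ∂(volume.restrict (Set.Ioc a b)), y ∈ Set.Icc a b :=
  (ae_restrict_mem measurableSet_Ioc).mono fun _ hy => Set.Ioc_subset_Icc_self hy

/-- The first column inside the upper circle. -/
noncomputable def innerFirstCol (h : GasData a b α β r p x t) (i : Fin 2) (z : ℂ) : ℂ :=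
  (1 : Matrix (Fin 2) (Fin 2) ℂ) i 0 + cauchyTransform (volume.restrict (Set.Ioc a b)) (-I)
    (fun y => lowerWeight a b α β r p x t y * (h.rowSolution i).1 y *
      kernelTransform h.pos h.integrable_upper y) z

/-- The second column inside the lower circle. -/
noncomputable def innerSecondCol (h : GasData a b α β r p x t) (i : Fin 2) (z : ℂ) : ℂ :=
  (1 : Matrix (Fin 2) (Fin 2) ℂ) i 1 - cauchyTransform (volume.restrict (Set.Ioc a b)) I
    (fun y => upperWeight a b α β r p x t y * (h.rowSolution i).2 y *
      kernelTransform h.pos h.integrable_lower y) z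

/-- The case `σ = 1` of the cancellation, with the equation for `g` as input. The right side is what
the jump on `Γ₊` requires inside the circle; the left side is visibly analytic off `-i[a,b]`. -/
theorem innerFirstCol_eq (h : GasData a b α β r p x t) (hab : a ≤ b) (i : Fin 2) {z : ℂ}
    (hz : ∀ y ∈ Set.Icc a b, z ≠ I * y) (hz' : ∀ y ∈ Set.Icc a b, z ≠ -I * y) :
    innerFirstCol h i z =
      h.firstCol i z - upperCauchy a b α β r p x t z * h.secondCol i z := by
  have key := cauchyTransform_sub_mul h.pos (ae_mem_Icc a b) (mul_one 1) h.integrable_upper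
    h.integrable_lower (h.rowSolution i).1 (h.rowSolution i).2
    ((1 : Matrix (Fin 2) (Fin 2) ℂ) i 1)
    (fun s => by rw [SmallData.rowSolution, one_mul]; exact h.solution_snd _ _ s) (z := z)
    (by simpa using hz) (by simpa using hz')
  simp only [one_mul] at key
  rw [innerFirstCol, ← key, upperCauchy_eq hab, SmallData.firstCol, SmallData.secondCol,
    add_sub_assoc]

/-- The case `σ = -1`, with the equation for `f` as input. -/
theorem innerSecondCol_eq (h : GasData a b α β r p x t) (hab : a ≤ b) (i : Fin 2) {z : ℂ}
    (hz : ∀ y ∈ Set.Icc a b, z ≠ I * y) (hz' : ∀ y ∈ Set.Icc a b, z ≠ -I * y) :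
    innerSecondCol h i z =
      h.secondCol i z - lowerCauchy a b α β r p x t z * h.firstCol i z := by
  have key := cauchyTransform_sub_mul h.pos (ae_mem_Icc a b) (σ := -1) (by norm_num)
    h.integrable_lower h.integrable_upper (h.rowSolution i).2 (h.rowSolution i).1
    ((1 : Matrix (Fin 2) (Fin 2) ℂ) i 0)
    (fun s => by
      rw [SmallData.rowSolution, neg_one_mul, ← sub_eq_add_neg]; exact h.solution_fst _ _ s)
    (z := z) (by simpa using hz') (by simpa using hz)
  simp only [neg_mul, one_mul, neg_neg] at key
  rw [innerSecondCol, sub_eq_add_neg, ← key, lowerCauchy_eq hab, SmallData.firstCol,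
    SmallData.secondCol, add_sub_assoc]

theorem differentiableAt_innerFirstCol (h : GasData a b α β r p x t) (i : Fin 2) {z : ℂ}
    (hz : ∀ y ∈ Set.Icc a b, z ≠ -I * y) : DifferentiableAt ℂ (innerFirstCol h i) z :=
  (differentiableAt_cauchyTransform (ae_mem_Icc a b)
    (integrable_mul_bcf (integrable_mul_bcf h.integrable_lower _) _) hz).const_add _

theorem differentiableAt_innerSecondCol (h : GasData a b α β r p x t) (i : Fin 2) {z : ℂ}
    (hz : ∀ y ∈ Set.Icc a b, z ≠ I * y) : DifferentiableAt ℂ (innerSecondCol h i) z :=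
  (differentiableAt_cauchyTransform (ae_mem_Icc a b)
    (integrable_mul_bcf (integrable_mul_bcf h.integrable_upper _) _) hz).const_sub _

theorem differentiableAt_firstCol_gas (h : GasData a b α β r p x t) (i : Fin 2) {z : ℂ}
    (hz : ∀ y ∈ Set.Icc a b, z ≠ I * y) : DifferentiableAt ℂ (h.firstCol i) z :=
  (differentiableAt_cauchyTransform (ae_mem_Icc a b)
    (integrable_mul_bcf h.integrable_upper _) hz).const_add _

theorem differentiableAt_secondCol_gas (h : GasData a b α β r p x t) (i : Fin 2) {z : ℂ}
    (hz : ∀ y ∈ Set.Icc a b, z ≠ -I * y) : DifferentiableAt ℂ (h.secondCol i) z :=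
  (differentiableAt_cauchyTransform (ae_mem_Icc a b)
    (integrable_mul_bcf h.integrable_lower _) hz).const_add _

open Classical in
/-- The solution of the soliton gas problem. -/
noncomputable def gasMatrix (ρ : ℝ) (h : GasData a b α β r p x t) (z : ℂ) :
    Matrix (Fin 2) (Fin 2) ℂ :=
  Matrix.of fun i =>
    ![if z ∈ Metric.ball (centre a b) ρ then innerFirstCol h i z else h.firstCol i z,
      if z ∈ Metric.ball (-centre a b) ρ then innerSecondCol h i z else h.secondCol i z]

theorem ne_of_notMem_ball (hρ₁ : (b - a) / 2 < ρ) {z : ℂ}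
    (hz : z ∉ Metric.ball (centre a b) ρ) : ∀ y ∈ Set.Icc a b, z ≠ I * y := by
  rintro y hy rfl
  refine hz ?_
  have h1 : I * (y : ℂ) - centre a b = I * ((y - (a + b) / 2 : ℝ) : ℂ) := by
    rw [centre]; push_cast; ring
  rw [mem_ball_iff_norm, h1, norm_mul, norm_I, one_mul, norm_real, Real.norm_eq_abs, abs_lt]
  constructor <;> linarith [hy.1, hy.2]

theorem ne_of_notMem_ball_neg (hρ₁ : (b - a) / 2 < ρ) {z : ℂ}
    (hz : z ∉ Metric.ball (-centre a b) ρ) : ∀ y ∈ Set.Icc a b, z ≠ -I * y := by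
  intro y hy h
  refine ne_of_notMem_ball (z := -z) hρ₁ (fun h' => hz ?_) y hy (by rw [h]; ring)
  rw [mem_ball_iff_norm] at h' ⊢
  rwa [← norm_neg, show -(z - -centre a b) = -z - centre a b by ring]

theorem centre_im (a b : ℝ) : (centre a b).im = (a + b) / 2 := by
  have h : centre a b = I * ((((a + b) / 2 : ℝ)) : ℂ) := by rw [centre]; push_cast; ring
  rw [h, I_mul_im, ofReal_re]

theorem im_pos_of_dist_le (hρ₂ : ρ < (a + b) / 2) {z : ℂ} (hz : dist z (centre a b) ≤ ρ) :
    0 < z.im := by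
  have h1 := (abs_le.1 ((abs_im_le_norm (z - centre a b)).trans
    ((dist_eq_norm z (centre a b)).symm.le.trans hz))).1
  rw [sub_im, centre_im] at h1
  linarith

theorem im_neg_of_dist_le (hρ₂ : ρ < (a + b) / 2) {z : ℂ} (hz : dist z (-centre a b) ≤ ρ) :
    z.im < 0 := by
  have h1 := (abs_le.1 ((abs_im_le_norm (z - -centre a b)).trans
    ((dist_eq_norm z (-centre a b)).symm.le.trans hz))).2
  rw [sub_im, neg_im, centre_im] at h1
  linarith

theorem ne_neg_of_im_pos (ha : 0 < a) {z : ℂ} (hz : 0 < z.im) :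
    ∀ y ∈ Set.Icc a b, z ≠ -I * y := by
  rintro y hy rfl
  have : 0 < y := ha.trans_le hy.1
  simp at hz
  linarith

theorem ne_of_im_neg (ha : 0 < a) {z : ℂ} (hz : z.im < 0) :
    ∀ y ∈ Set.Icc a b, z ≠ I * y := by
  rintro y hy rfl
  have : 0 < y := ha.trans_le hy.1
  simp at hz
  linarith

open Classical in
theorem differentiableAt_ite_ball {F G : ℂ → ℂ} {c z : ℂ} (hz : z ∉ Metric.sphere c ρ)
    (hF : z ∈ Metric.ball c ρ → DifferentiableAt ℂ F z)
    (hG : z ∉ Metric.ball c ρ → DifferentiableAt ℂ G z) :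
    DifferentiableAt ℂ (fun z => if z ∈ Metric.ball c ρ then F z else G z) z := by
  by_cases h : z ∈ Metric.ball c ρ
  · refine (hF h).congr_of_eventuallyEq ?_
    filter_upwards [Metric.isOpen_ball.mem_nhds h] with w hw
    rw [if_pos hw]
  · refine (hG h).congr_of_eventuallyEq ?_
    have h' : z ∈ (Metric.closedBall c ρ)ᶜ := fun hc =>
      (Metric.ball_union_sphere (x := c) (ε := ρ) ▸ hc).elim h hz
    filter_upwards [Metric.isClosed_closedBall.isOpen_compl.mem_nhds h'] with w hw
    rw [if_neg fun hb => hw (Metric.ball_subset_closedBall hb)]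

theorem tendsto_fin_two {l : Filter ℂ} {M : ℂ → Matrix (Fin 2) (Fin 2) ℂ} {F G : Fin 2 → ℂ → ℂ}
    {z : ℂ} (hl : l ≤ 𝓝 z) (hF : ∀ i, ContinuousAt (F i) z) (hG : ∀ i, ContinuousAt (G i) z)
    (h0 : ∀ᶠ w in l, ∀ i, M w i 0 = F i w) (h1 : ∀ᶠ w in l, ∀ i, M w i 1 = G i w) :
    Tendsto M l (𝓝 (Matrix.of fun i => ![F i z, G i z])) := by
  refine tendsto_pi_nhds.2 fun i => tendsto_pi_nhds.2 fun j => ?_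
  fin_cases j
  · exact ((hF i).tendsto.mono_left hl).congr' (h0.mono fun w hw => (hw i).symm)
  · exact ((hG i).tendsto.mono_left hl).congr' (h1.mono fun w hw => (hw i).symm)

theorem gasMatrix_zero (h : GasData a b α β r p x t) {z : ℂ}
    (hz : z ∉ Metric.ball (centre a b) ρ) (i : Fin 2) : gasMatrix ρ h z i 0 = h.firstCol i z := by
  simp [gasMatrix, hz]

theorem gasMatrix_zero_inner (h : GasData a b α β r p x t) {z : ℂ}
    (hz : z ∈ Metric.ball (centre a b) ρ) (i : Fin 2) : gasMatrix ρ h z i 0 = innerFirstCol h i z := by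
  simp [gasMatrix, hz]

theorem gasMatrix_one (h : GasData a b α β r p x t) {z : ℂ}
    (hz : z ∉ Metric.ball (-centre a b) ρ) (i : Fin 2) :
    gasMatrix ρ h z i 1 = h.secondCol i z := by
  simp [gasMatrix, hz]

theorem gasMatrix_one_inner (h : GasData a b α β r p x t) {z : ℂ}
    (hz : z ∈ Metric.ball (-centre a b) ρ) (i : Fin 2) :
    gasMatrix ρ h z i 1 = innerSecondCol h i z := by
  simp [gasMatrix, hz]

theorem gasMatrix_eq_at_infinity (h : GasData a b α β r p x t) :
    ∀ᶠ z in cobounded ℂ, ∀ i, gasMatrix ρ h z i 0 = h.firstCol i z ∧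
      gasMatrix ρ h z i 1 = h.secondCol i z := by
  filter_upwards [isBounded_def.1 (Metric.isBounded_ball (x := centre a b) (r := ρ)),
    isBounded_def.1 (Metric.isBounded_ball (x := -centre a b) (r := ρ))] with z h1 h2 i
  exact ⟨gasMatrix_zero h h1 i, gasMatrix_one h h2 i⟩

theorem abs_le_ae (ha : 0 < a) : ∀ᵐ y ∂(volume.restrict (Set.Ioc a b)), |y| ≤ b :=
  (ae_mem_Icc a b).mono fun _ hy => abs_le_of_mem_Icc ha hy

theorem solves_gasMatrix (h : GasData a b α β r p x t) (hab : a ≤ b) (hρ₁ : (b - a) / 2 < ρ)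
    (hρ₂ : ρ < (a + b) / 2) : SolvesGasRHP a b α β ρ r p x t (gasMatrix ρ h) where
  analytic i j := by
    intro z hz
    refine DifferentiableAt.differentiableWithinAt ?_
    fin_cases j
    · refine differentiableAt_ite_ball (fun hc => hz (Or.inl hc)) (fun hb => ?_) (fun hb => ?_)
      · exact differentiableAt_innerFirstCol h i
          (ne_neg_of_im_pos h.pos (im_pos_of_dist_le hρ₂ (Metric.mem_ball.1 hb).le))
      · exact differentiableAt_firstCol_gas h i (ne_of_notMem_ball hρ₁ hb)
    · refine differentiableAt_ite_ball (fun hc => hz (Or.inr hc)) (fun hb => ?_) (fun hb => ?_)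
      · exact differentiableAt_innerSecondCol h i
          (ne_of_im_neg h.pos (im_neg_of_dist_le hρ₂ (Metric.mem_ball.1 hb).le))
      · exact differentiableAt_secondCol_gas h i (ne_of_notMem_ball_neg hρ₁ hb)
  normalized := h.normalized_of_eq (abs_le_ae h.pos) (gasMatrix_eq_at_infinity h)
  jump_upper z hz := by
    have hpos : 0 < z.im := im_pos_of_dist_le hρ₂ (Metric.mem_sphere.1 hz).le
    -- The circles lie in opposite half-planes, so near `Γ₊` only the first column switches formula.
    have hup : ∀ᶠ w in 𝓝 z, w ∉ Metric.ball (-centre a b) ρ := by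
      filter_upwards [(continuous_im.isOpen_preimage _ isOpen_Ioi).mem_nhds hpos] with w hw hb
      exact lt_asymm hw (im_neg_of_dist_le hρ₂ (Metric.mem_ball.1 hb).le)
    have h1 := ne_of_notMem_ball hρ₁ fun hb => (Metric.mem_ball.1 hb).ne (Metric.mem_sphere.1 hz)
    have h2 := ne_neg_of_im_pos (b := b) h.pos hpos
    refine ⟨_, _, tendsto_fin_two nhdsWithin_le_nhds
      (fun i => (differentiableAt_innerFirstCol h i h2).continuousAt)
      (fun i => (differentiableAt_secondCol_gas h i h2).continuousAt)
      ?_ ?_, tendsto_fin_two nhdsWithin_le_nhds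
      (fun i => (differentiableAt_firstCol_gas h i h1).continuousAt)
      (fun i => (differentiableAt_secondCol_gas h i h2).continuousAt) ?_ ?_, ?_⟩
    · filter_upwards [self_mem_nhdsWithin] with w hw i using gasMatrix_zero_inner h hw i
    · filter_upwards [mem_nhdsWithin_of_mem_nhds hup] with w hw i using gasMatrix_one h hw i
    · filter_upwards [self_mem_nhdsWithin] with w hw i using
        gasMatrix_zero h (fun hb => hw (Metric.ball_subset_closedBall hb)) i
    · filter_upwards [mem_nhdsWithin_of_mem_nhds hup] with w hw i using gasMatrix_one h hw i
    · ext i j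
      fin_cases j
      · simp [Matrix.mul_apply, Fin.sum_univ_two, innerFirstCol_eq h hab i h1 h2]
        ring
      · simp [Matrix.mul_apply, Fin.sum_univ_two]
  jump_lower z hz := by
    have hneg : z.im < 0 := im_neg_of_dist_le hρ₂ (Metric.mem_sphere.1 hz).le
    have hdown : ∀ᶠ w in 𝓝 z, w ∉ Metric.ball (centre a b) ρ := by
      filter_upwards [(continuous_im.isOpen_preimage _ isOpen_Iio).mem_nhds hneg] with w hw hb
      exact lt_asymm hw (im_pos_of_dist_le hρ₂ (Metric.mem_ball.1 hb).le)
    have h2 := ne_of_notMem_ball_neg hρ₁ fun hb =>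
      (Metric.mem_ball.1 hb).ne (Metric.mem_sphere.1 hz)
    have h1 := ne_of_im_neg (b := b) h.pos hneg
    refine ⟨_, _, tendsto_fin_two nhdsWithin_le_nhds
      (fun i => (differentiableAt_firstCol_gas h i h1).continuousAt)
      (fun i => (differentiableAt_secondCol_gas h i h2).continuousAt)
      ?_ ?_, tendsto_fin_two nhdsWithin_le_nhds
      (fun i => (differentiableAt_firstCol_gas h i h1).continuousAt)
      (fun i => (differentiableAt_innerSecondCol h i h1).continuousAt) ?_ ?_, ?_⟩
    · filter_upwards [mem_nhdsWithin_of_mem_nhds hdown] with w hw i using gasMatrix_zero h hw i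
    · filter_upwards [self_mem_nhdsWithin] with w hw i using
        gasMatrix_one h (fun hb => hw (Metric.ball_subset_closedBall hb)) i
    · filter_upwards [mem_nhdsWithin_of_mem_nhds hdown] with w hw i using gasMatrix_zero h hw i
    · filter_upwards [self_mem_nhdsWithin] with w hw i using gasMatrix_one_inner h hw i
    · ext i j
      fin_cases j
      · simp [Matrix.mul_apply, Fin.sum_univ_two]
      · simp [Matrix.mul_apply, Fin.sum_univ_two, innerSecondCol_eq h hab i h1 h2]
        ring

/-- With small data, the potential of the integral equations is the soliton gas potential. -/
theorem isGasPotential (h : GasData a b α β r p x t) (hab : a ≤ b) (hρ₁ : (b - a) / 2 < ρ)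
    (hρ₂ : ρ < (a + b) / 2) : IsGasPotential a b α β ρ r p x t h.potential := by
  have hsol := solves_gasMatrix h hab hρ₁ hρ₂
  refine ⟨⟨_, hsol⟩, fun M hM => ?_⟩
  have h1 : RecoveredFrom (gasMatrix ρ h) h.potential :=
    h.recoveredFrom_of_eq (abs_le_ae h.pos) (gasMatrix_eq_at_infinity h)
  exact h1.congr (hsol.unique (by linarith) hρ₂ hM)

end Gas

/-! ### Convergence of quantile sums by transport -/

section Quantile

/-- A probability density on `[a,b]` with a continuous representative. -/
structure IsContDensity (a b : ℝ) (p : ℝ → ℝ) : Prop where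
  lt : a < b
  cont : ContinuousOn p (Set.Icc a b)
  nonneg : ∀ y ∈ Set.Icc a b, 0 ≤ p y
  mass : ∫ y in a..b, p y = 1

namespace IsContDensity

variable {a b : ℝ} {p : ℝ → ℝ} (hp : IsContDensity a b p)
include hp

theorem intervalIntegrable {y z : ℝ} (hy : y ∈ Set.Icc a b) (hz : z ∈ Set.Icc a b) :
    IntervalIntegrable p volume y z :=
  (hp.cont.mono (Set.uIcc_subset_Icc hy hz)).intervalIntegrable

theorem left_mem : a ∈ Set.Icc a b := Set.left_mem_Icc.2 hp.lt.le

theorem right_mem : b ∈ Set.Icc a b := Set.right_mem_Icc.2 hp.lt.le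

theorem integral_sub {y z : ℝ} (hy : y ∈ Set.Icc a b) (hz : z ∈ Set.Icc a b) :
    (∫ u in a..z, p u) - ∫ u in a..y, p u = ∫ u in y..z, p u :=
  intervalIntegral.integral_interval_sub_left (hp.intervalIntegrable hp.left_mem hz)
    (hp.intervalIntegrable hp.left_mem hy)

theorem integral_mono_right {y z : ℝ} (hy : y ∈ Set.Icc a b) (hz : z ∈ Set.Icc a b) (hyz : y ≤ z) :
    ∫ u in a..y, p u ≤ ∫ u in a..z, p u := by
  rw [← sub_nonneg, hp.integral_sub hy hz]
  exact intervalIntegral.integral_nonneg hyz fun u hu =>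
    hp.nonneg u ⟨hy.1.trans hu.1, hu.2.trans hz.2⟩

theorem lt_of_integral_lt {y z : ℝ} (hy : y ∈ Set.Icc a b) (hz : z ∈ Set.Icc a b)
    (h : ∫ u in a..y, p u < ∫ u in a..z, p u) : y < z := by
  by_contra! hle
  exact absurd (hp.integral_mono_right hz hy hle) (not_le.2 h)

theorem integral_lt_of_pos {y z : ℝ} (hy : y ∈ Set.Icc a b) (hz : z ∈ Set.Icc a b) (hyz : y < z)
    (hpos : 0 < p y) : ∫ u in a..y, p u < ∫ u in a..z, p u := by
  rw [← sub_pos, hp.integral_sub hy hz]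
  exact intervalIntegral.integral_pos hyz (hp.cont.mono (Set.Icc_subset_Icc hy.1 hz.2))
    (fun u hu => hp.nonneg u ⟨hy.1.trans hu.1.le, hu.2.trans hz.2⟩)
    ⟨y, Set.left_mem_Icc.2 hyz.le, hpos⟩

/-- The equal-weight atoms at the quantiles are the image of the density `p` under a map which
moves no point across more than the mass `1 / N`. -/
theorem exists_transport {N : ℕ} (hN : 0 < N) {s : Fin N → ℝ} (hs : ∀ j, s j ∈ Set.Icc a b)
    (hq : ∀ j : Fin N, ∫ y in a..s j, p y = ((j : ℕ) + 1 : ℝ) / N) :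
    ∃ T : ℝ → ℝ, (∀ y, T y ∈ Set.Icc a b) ∧
      (∀ h : ℝ → ℂ, IntervalIntegrable (fun y => h (T y) * p y) volume a b ∧
        ∫ y in a..b, h (T y) * p y = ∑ j, h (s j) / N) ∧
      (∀ y ∈ Set.Ioo a b, 0 < p y → y ≤ T y ∧
        (∫ u in a..T y, p u) ≤ (∫ u in a..y, p u) + 1 / N) := by
  classical
  have hN' : (0 : ℝ) < N := by exact_mod_cast hN
  -- Quantiles indexed from one, with `σ 0 = a`, so that each interval `(σ j, σ (j + 1)]` with `j <
  -- N` carries mass `1 / N`. The value `a` for `j > N` plays no role.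
  let σ : ℕ → ℝ := fun j => if h : 0 < j ∧ j ≤ N then s ⟨j - 1, by omega⟩ else a
  have hσ0 : σ 0 = a := by simp [σ]
  have hσs : ∀ j (hj : j < N), σ (j + 1) = s ⟨j, hj⟩ := fun j hj => by
    have : 0 < j + 1 ∧ j + 1 ≤ N := ⟨by omega, hj⟩
    simp only [σ, dif_pos this]
    congr 1
  have hσm : ∀ j, σ j ∈ Set.Icc a b := fun j => by
    by_cases h : 0 < j ∧ j ≤ N
    · simp only [σ, dif_pos h]; exact hs _
    · simp only [σ, dif_neg h]; exact hp.left_mem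
  have hσP : ∀ j ≤ N, ∫ y in a..σ j, p y = j / N := by
    intro j hj
    rcases j with _ | j
    · simp [hσ0]
    · rw [hσs j hj, hq]; push_cast; rfl
  have hσmono : ∀ i j, i < j → j ≤ N → σ i < σ j := by
    intro i j hij hj
    refine hp.lt_of_integral_lt (hσm i) (hσm j) ?_
    rw [hσP i (hij.le.trans hj), hσP j hj]
    gcongr
  have hσle : ∀ i j, i ≤ j → j ≤ N → σ i ≤ σ j := fun i j hij hj => by
    rcases hij.eq_or_lt with rfl | h
    · exact le_rfl
    · exact (hσmono i j h hj).le
  -- Each point goes to the right end of its quantile interval. The default `b` is taken only beyond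
  -- `σ N`, where no mass is left.
  let T : ℝ → ℝ := fun y => if h : ∃ j, j < N ∧ y ≤ σ (j + 1) then σ (Nat.find h + 1) else b
  have hTσ : ∀ j, j < N → ∀ y ∈ Set.Ioc (σ j) (σ (j + 1)), T y = σ (j + 1) := by
    intro j hj y hy
    have hex : ∃ j, j < N ∧ y ≤ σ (j + 1) := ⟨j, hj, hy.2⟩
    have : Nat.find hex = j := by
      rw [Nat.find_eq_iff]
      refine ⟨⟨hj, hy.2⟩, fun n hn hc => ?_⟩
      exact absurd (hc.2.trans (hσle (n + 1) j hn hj.le)) (not_le.2 hy.1)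
    simp only [T, dif_pos hex, this]
  have hTm : ∀ y, T y ∈ Set.Icc a b := fun y => by
    by_cases h : ∃ j, j < N ∧ y ≤ σ (j + 1)
    · simp only [T, dif_pos h]; exact hσm _
    · simp only [T, dif_neg h]; exact hp.right_mem
  have hP1 : ∫ y in a..σ N, p y = 1 := by rw [hσP N le_rfl, div_self hN'.ne']
  refine ⟨T, hTm, fun h => ?_, fun y hy hpy => ?_⟩
  · have hpc : ∀ {y z : ℝ}, y ∈ Set.Icc a b → z ∈ Set.Icc a b →
        IntervalIntegrable (fun u => (p u : ℂ)) volume y z := fun hy hz =>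
      (Complex.continuous_ofReal.comp_continuousOn
        (hp.cont.mono (Set.uIcc_subset_Icc hy hz))).intervalIntegrable
    have hpiece : ∀ j, j < N → Set.EqOn (fun y => h (σ (j + 1)) * p y)
        (fun y => h (T y) * p y) (Set.uIoc (σ j) (σ (j + 1))) := by
      intro j hj y hy
      rw [Set.uIoc_of_le (hσmono j (j + 1) (by omega) hj).le] at hy
      simp only [hTσ j hj y hy]
    have hint : ∀ j, j < N → IntervalIntegrable (fun y => h (T y) * p y) volume
        (σ j) (σ (j + 1)) := fun j hj =>
      ((hpc (hσm j) (hσm (j + 1))).const_mul _).congr (hpiece j hj)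
    have hval : ∀ j (hj : j < N), ∫ y in σ j..σ (j + 1), h (T y) * p y = h (s ⟨j, hj⟩) / N := by
      intro j hj
      rw [← intervalIntegral.integral_congr_ae (ae_of_all _ (hpiece j hj)),
        intervalIntegral.integral_const_mul,
        intervalIntegral.integral_ofReal, ← hp.integral_sub (hσm j) (hσm (j + 1)),
        hσP j hj.le, hσP (j + 1) hj, hσs j hj, div_eq_mul_inv]
      congr 1
      push_cast
      field_simp
      ring
    -- If `p` vanishes near `b`, the last quantile may lie strictly below `b`; the whole mass is
    -- already used up at `σ N`, so `p = 0` almost everywhere after it.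
    have hzero : ∀ᵐ y ∂(volume.restrict (Set.Ioc (σ N) b)), h (T y) * p y = 0 := by
      have h0 : ∫ y in σ N..b, p y = 0 := by
        rw [← hp.integral_sub (hσm N) hp.right_mem, hp.mass, hP1, sub_self]
      rw [intervalIntegral.integral_of_le (hσm N).2, integral_eq_zero_iff_of_nonneg_ae] at h0
      · filter_upwards [h0] with y hy
        rw [hy]; simp
      · filter_upwards [ae_restrict_mem measurableSet_Ioc] with y hy
        exact hp.nonneg y ⟨(hσm N).1.trans hy.1.le, hy.2⟩
      · exact (hp.intervalIntegrable (hσm N) hp.right_mem).1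
    have hlast : IntervalIntegrable (fun y => h (T y) * p y) volume (σ N) b := by
      rw [intervalIntegrable_iff_integrableOn_Ioc_of_le (hσm N).2]
      exact (integrable_zero _ _ _).congr (hzero.mono fun y hy => hy.symm)
    have hfirst : IntervalIntegrable (fun y => h (T y) * p y) volume a (σ N) := by
      rw [← hσ0]; exact IntervalIntegrable.trans_iterate hint
    refine ⟨hfirst.trans hlast, ?_⟩
    rw [← intervalIntegral.integral_add_adjacent_intervals hfirst hlast]
    have e1 : ∫ y in σ N..b, h (T y) * p y = 0 := by
      rw [intervalIntegral.integral_of_le (hσm N).2]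
      exact integral_eq_zero_of_ae hzero
    have e2 := intervalIntegral.sum_integral_adjacent_intervals hint
    rw [hσ0] at e2
    rw [e1, add_zero, ← e2, Finset.sum_range]
    exact Finset.sum_congr rfl fun j _ => hval j j.2
  · have hyI : y ∈ Set.Icc a b := Set.Ioo_subset_Icc_self hy
    have hlt : y < σ N := by
      refine hp.lt_of_integral_lt hyI (hσm N) ?_
      rw [hP1, ← hp.mass]
      exact hp.integral_lt_of_pos hyI hp.right_mem hy.2 hpy
    have hex : ∃ j, j < N ∧ y ≤ σ (j + 1) := ⟨N - 1, by omega, by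
      rw [Nat.sub_add_cancel hN]; exact hlt.le⟩
    have hT : T y = σ (Nat.find hex + 1) := by simp only [T, dif_pos hex]
    obtain ⟨hjN, hyj⟩ := Nat.find_spec hex
    rw [hT]
    refine ⟨hyj, ?_⟩
    have hlow : σ (Nat.find hex) ≤ y := by
      rcases hj : Nat.find hex with _ | j
      · rw [hσ0]; exact hy.1.le
      · have := Nat.find_min hex (m := j) (by omega)
        by_contra! hc
        exact this ⟨by omega, hc.le⟩
    have h1 := hp.integral_mono_right (hσm _) hyI hlow
    rw [hσP _ hjN.le] at h1
    rw [hσP _ hjN]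
    push_cast
    rw [add_div]
    linarith

/-- The maps of `exists_transport` converge to the identity wherever `p` is positive. -/
theorem tendsto_transport {T : ℕ → ℝ → ℝ} (hT : ∀ N y, T N y ∈ Set.Icc a b) {y : ℝ}
    (hy : y ∈ Set.Ioo a b) (hpy : 0 < p y)
    (h : ∀ᶠ N : ℕ in atTop, y ≤ T N y ∧ (∫ u in a..T N y, p u) ≤ (∫ u in a..y, p u) + 1 / N) :
    Tendsto (fun N => T N y) atTop (𝓝 y) := by
  have hyI : y ∈ Set.Icc a b := Set.Ioo_subset_Icc_self hy
  refine tendsto_order.2 ⟨fun l hl => h.mono fun N hN => hl.trans_le hN.1, fun l hl => ?_⟩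
  -- Since `p y > 0`, the cumulative mass increases strictly just after `y`. An excess of at most `1
  -- / N` therefore eventually keeps `T N y` below this point.
  have hz : min l b ∈ Set.Icc a b := ⟨le_min (hy.1.trans hl).le hp.lt.le, min_le_right _ _⟩
  have hlt := hp.integral_lt_of_pos hyI hz (lt_min hl hy.2) hpy
  have h1 : Tendsto (fun N : ℕ => (∫ u in a..y, p u) + 1 / (N : ℝ)) atTop
      (𝓝 ((∫ u in a..y, p u) + 0)) := tendsto_one_div_atTop_nhds_zero_nat.const_add _
  rw [add_zero] at h1
  filter_upwards [h, h1.eventually_lt_const hlt] with N hN hN'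
  exact (hp.lt_of_integral_lt (hT N y) hz (hN.2.trans_lt hN')).trans_le (min_le_left _ _)

/-- If `T N → id` and `H` is bounded on `[a,b]` and continuous inside, then `H ∘ T N → H` in
`L¹(p)`. -/
theorem tendsto_integral_transport {T : ℕ → ℝ → ℝ} (hT : ∀ N y, T N y ∈ Set.Icc a b)
    (hlim : ∀ y ∈ Set.Ioo a b, 0 < p y → Tendsto (fun N => T N y) atTop (𝓝 y))
    {H : ℝ → ℂ} {K : ℝ} (hH : ContinuousOn H (Set.Ioo a b)) (hK : ∀ y ∈ Set.Icc a b, ‖H y‖ ≤ K)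
    (hmeas : ∀ᶠ N in atTop, IntervalIntegrable (fun y => H (T N y) * p y) volume a b) :
    IntervalIntegrable (fun y => H y * p y) volume a b ∧
    Tendsto (fun N => ∫ y in a..b, ‖H (T N y) * p y - H y * p y‖) atTop (𝓝 0) := by
  have hK0 : 0 ≤ K := (norm_nonneg _).trans (hK a hp.left_mem)
  have hab := hp.lt.le
  have hbd : ∀ y ∈ Set.Ioc a b, ∀ z ∈ Set.Icc a b, ‖H z * p y‖ ≤ K * p y := fun y hy z hz => by
    have hpy := hp.nonneg y (Set.Ioc_subset_Icc_self hy)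
    rw [norm_mul, norm_real, Real.norm_of_nonneg hpy]
    exact mul_le_mul_of_nonneg_right (hK z hz) hpy
  have hpi : IntegrableOn p (Set.Ioc a b) :=
    (hp.intervalIntegrable hp.left_mem hp.right_mem).1
  have hHm : AEStronglyMeasurable (fun y => H y * p y) (volume.restrict (Set.Ioc a b)) := by
    rw [← restrict_Ioo_eq_restrict_Ioc]
    exact (hH.mul (Complex.continuous_ofReal.comp_continuousOn
      (hp.cont.mono Set.Ioo_subset_Icc_self))).aestronglyMeasurable measurableSet_Ioo
  have hHi : IntervalIntegrable (fun y => H y * p y) volume a b := by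
    rw [intervalIntegrable_iff_integrableOn_Ioc_of_le hab]
    refine (hpi.const_mul K).mono' hHm ?_
    filter_upwards [ae_restrict_mem measurableSet_Ioc] with y hy
    exact hbd y hy y (Set.Ioc_subset_Icc_self hy)
  refine ⟨hHi, ?_⟩
  simp only [intervalIntegral.integral_of_le hab]
  rw [← integral_zero ℝ ℝ (μ := volume.restrict (Set.Ioc a b))]
  refine tendsto_integral_filter_of_dominated_convergence (fun y => K * p y + K * p y) ?_ ?_
    ((hpi.const_mul K).add (hpi.const_mul K)) ?_
  · filter_upwards [hmeas] with N hN
    rw [intervalIntegrable_iff_integrableOn_Ioc_of_le hab] at hN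
    exact (hN.aestronglyMeasurable.sub hHm).norm
  · refine Eventually.of_forall fun N => ?_
    filter_upwards [ae_restrict_mem measurableSet_Ioc] with y hy
    rw [norm_norm]
    exact (norm_sub_le _ _).trans (add_le_add (hbd y hy _ (hT N y))
      (hbd y hy y (Set.Ioc_subset_Icc_self hy)))
  · rw [← restrict_Ioo_eq_restrict_Ioc]
    filter_upwards [ae_restrict_mem measurableSet_Ioo] with y hy
    -- Where `p y = 0` nothing is known about `T N y`, but both integrands vanish there.
    rcases (hp.nonneg y (Set.Ioo_subset_Icc_self hy)).eq_or_lt with h0 | h0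
    · simp [← h0]
    · have h1 : Tendsto (fun N => H (T N y)) atTop (𝓝 (H y)) :=
        ((hH.continuousAt (isOpen_Ioo.mem_nhds hy)).tendsto).comp (hlim y hy h0)
      have h2 := ((h1.mul_const (p y : ℂ)).sub_const (H y * p y)).norm
      rwa [sub_self, norm_zero] at h2

/-- The quantile sums converge, uniformly over equi-Lipschitz and equibounded test functions. -/
theorem exists_uniform_quantile_bound {s : (N : ℕ) → Fin N → ℝ} (hs : ∀ N j, s N j ∈ Set.Icc a b)
    (hq : ∀ N (j : Fin N), ∫ y in a..s N j, p y = ((j : ℕ) + 1 : ℝ) / N) {H : ℝ → ℂ} {K : ℝ}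
    (hH : ContinuousOn H (Set.Ioo a b)) (hK : ∀ y ∈ Set.Icc a b, ‖H y‖ ≤ K) (c L : ℝ) :
    ∃ η : ℕ → ℝ, Tendsto η atTop (𝓝 0) ∧ ∀ᶠ N in atTop, ∀ k : ℝ → ℂ, Continuous k →
      (∀ y, ‖k y‖ ≤ c) → (∀ y y', ‖k y - k y'‖ ≤ L * |y - y'|) →
      ‖(∑ j, H (s N j) * k (s N j) / N) - ∫ y in a..b, H y * k y * p y‖ ≤ η N := by
  have hab := hp.lt.le
  have hex : ∀ N : ℕ, ∃ T : ℝ → ℝ, (∀ y, T y ∈ Set.Icc a b) ∧ (0 < N →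
      (∀ h : ℝ → ℂ, IntervalIntegrable (fun y => h (T y) * p y) volume a b ∧
        ∫ y in a..b, h (T y) * p y = ∑ j, h (s N j) / N) ∧
      (∀ y ∈ Set.Ioo a b, 0 < p y → y ≤ T y ∧
        (∫ u in a..T y, p u) ≤ (∫ u in a..y, p u) + 1 / N)) := by
    intro N
    rcases Nat.eq_zero_or_pos N with h0 | h0
    · exact ⟨fun _ => a, fun _ => hp.left_mem, fun h => absurd h0 h.ne'⟩
    · obtain ⟨T, h1, h2⟩ := hp.exists_transport h0 (hs N) (hq N)
      exact ⟨T, h1, fun _ => h2⟩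
  choose T hTm hT using hex
  have hlim : ∀ y ∈ Set.Ioo a b, 0 < p y → Tendsto (fun N => T N y) atTop (𝓝 y) :=
    fun y hy hpy => hp.tendsto_transport hTm hy hpy
      ((eventually_gt_atTop 0).mono fun N hN => (hT N hN).2 y hy hpy)
  have hmeas : ∀ H : ℝ → ℂ, ∀ᶠ N in atTop,
      IntervalIntegrable (fun y => H (T N y) * p y) volume a b := fun H =>
    (eventually_gt_atTop 0).mono fun N hN => ((hT N hN).1 H).1
  obtain ⟨hHi, hHlim⟩ := hp.tendsto_integral_transport hTm hlim hH hK (hmeas H)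
  -- Transport applied to the identity function: `∫ |T N y - y| p(y) dy → 0`, which controls every
  -- Lipschitz `k` at once.
  obtain ⟨hIi, hIlim⟩ := hp.tendsto_integral_transport hTm hlim (H := fun y => (y : ℂ))
    (K := max |a| |b|) (by fun_prop)
    (fun y hy => by rw [norm_real]; exact abs_le_max_abs_abs hy.1 hy.2) (hmeas _)
  refine ⟨fun N => c * (∫ y in a..b, ‖H (T N y) * p y - H y * p y‖) +
    K * L * ∫ y in a..b, ‖(T N y : ℂ) * p y - y * p y‖, ?_, ?_⟩
  · have := (hHlim.const_mul c).add (hIlim.const_mul (K * L))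
    simpa using this
  · filter_upwards [eventually_gt_atTop 0] with N hN k hk hkc hkL
    have hc0 : 0 ≤ c := (norm_nonneg _).trans (hkc 0)
    have hi1 := ((hT N hN).1 (fun y => H y * k y)).1
    have hi2 : IntervalIntegrable (fun y => H y * k y * p y) volume a b := by
      have := hHi.mul_continuousOn (g := k) hk.continuousOn
      refine this.congr fun y _ => ?_
      ring
    have hj1 := (((hT N hN).1 H).1.sub hHi).norm
    have hj2 := (((hT N hN).1 (fun y => (y : ℂ))).1.sub hIi).norm
    rw [← ((hT N hN).1 (fun y => H y * k y)).2, ← intervalIntegral.integral_sub hi1 hi2,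
      ← intervalIntegral.integral_const_mul, ← intervalIntegral.integral_const_mul,
      ← intervalIntegral.integral_add (hj1.const_mul c) (hj2.const_mul (K * L))]
    refine intervalIntegral.norm_integral_le_of_norm_le hab ?_
      ((hj1.const_mul c).add (hj2.const_mul (K * L)))
    refine ae_of_all _ fun y hy => ?_
    have hpy := hp.nonneg y (Set.Ioc_subset_Icc_self hy)
    -- In the first term `k` enters only through its bound `c`, in the second only through its
    -- Lipschitz constant `L`; hence the uniformity in `k`.
    have e : H (T N y) * k (T N y) * p y - H y * k y * p y =
        k (T N y) * (H (T N y) * p y - H y * p y) + H y * (k (T N y) - k y) * p y := by ring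
    have e2 : ‖(T N y : ℂ) * p y - y * p y‖ = |T N y - y| * p y := by
      rw [← sub_mul, ← ofReal_sub, norm_mul, norm_real, norm_real, Real.norm_eq_abs,
        Real.norm_of_nonneg hpy]
    rw [e, e2]
    refine (norm_add_le _ _).trans (add_le_add ?_ ?_)
    · rw [norm_mul]
      exact mul_le_mul_of_nonneg_right (hkc _) (norm_nonneg _)
    · rw [norm_mul, norm_mul, norm_real, Real.norm_of_nonneg hpy, ← mul_assoc, mul_assoc K]
      refine mul_le_mul_of_nonneg_right (mul_le_mul (hK y (Set.Ioc_subset_Icc_self hy))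
        (hkL _ _) (norm_nonneg _) ?_) hpy
      exact (norm_nonneg _).trans (hK a hp.left_mem)

end IsContDensity

end Quantile

/-! ### Stability of the fixed point -/

section Stability

/-- The potential depends continuously on the data, for strong convergence of the integral
operators. -/
theorem SmallData.tendsto_potential {a : ℝ} {ν : ℕ → Measure ℝ} {vp vm : ℕ → ℝ → ℂ}
    (hN : ∀ N, SmallData a (ν N) (vp N) (vm N)) {μ : Measure ℝ} {wp wm : ℝ → ℂ}
    (h : SmallData a μ wp wm)
    (hup : ∀ f : BoundedContinuousFunction ℝ ℂ, Tendsto (fun N =>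
      dist (kernelTransform h.pos (integrable_mul_bcf (hN N).integrable_upper f))
        (kernelTransform h.pos (integrable_mul_bcf h.integrable_upper f))) atTop (𝓝 0))
    (hlow : ∀ f : BoundedContinuousFunction ℝ ℂ, Tendsto (fun N =>
      dist (kernelTransform h.pos (integrable_mul_bcf (hN N).integrable_lower f))
        (kernelTransform h.pos (integrable_mul_bcf h.integrable_lower f))) atTop (𝓝 0))
    (hint : ∀ f : BoundedContinuousFunction ℝ ℂ, Tendsto (fun N => ∫ y, vm N y * f y ∂(ν N)) atTop
      (𝓝 (∫ y, wm y * f y ∂μ))) :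
    Tendsto (fun N => (hN N).potential) atTop (𝓝 h.potential) := by
  set u := h.solution 1 0 with hu
  have h1 : Tendsto (fun N => dist u ((hN N).solution 1 0)) atTop (𝓝 0) := by
    have h2 := ((hup u.2).max (hlow u.1)).const_mul 2
    rw [max_self, mul_zero] at h2
    refine squeeze_zero (fun _ => dist_nonneg) (fun N => ?_) h2
    refine ((hN N).dist_solution_le 1 0 u).trans ?_
    -- As `u` is fixed by the limiting map, its defect for the `N`-th map is the difference of the
    -- two maps at this single `u`. Convergence of the operators on each fixed function is therefore
    -- enough.
    have h3 : dist u ((hN N).rhs 1 0 u) = dist ((hN N).rhs 1 0 u) (h.rhs 1 0 u) := by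
      rw [hu, h.rhs_solution, dist_comm]
    rw [h3, Prod.dist_eq]
    simp only [rhs, dist_sub_left, dist_add_left]
    exact le_rfl
  refine Tendsto.const_mul _ ?_
  have h4 : Tendsto (fun N => (∫ y, vm N y * ((hN N).solution 1 0).1 y ∂(ν N)) -
      ∫ y, vm N y * u.1 y ∂(ν N)) atTop (𝓝 0) := by
    have h5 := h1.const_mul a
    rw [mul_zero] at h5
    refine squeeze_zero_norm (fun N => ?_) h5
    rw [← integral_sub (integrable_mul_bcf (hN N).integrable_lower _)
      (integrable_mul_bcf (hN N).integrable_lower _)]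
    have h6 : ∀ y, vm N y * ((hN N).solution 1 0).1 y - vm N y * u.1 y =
        vm N y * (((hN N).solution 1 0).1 - u.1) y := fun y => by
      rw [BoundedContinuousFunction.sub_apply]; ring
    simp_rw [h6]
    refine (norm_integral_mul_bcf_le (hN N).integrable_lower _).trans ?_
    refine mul_le_mul (hN N).lower_le ?_ (norm_nonneg _) h.pos.le
    rw [← dist_eq_norm, dist_comm]
    exact (le_max_left _ _).trans_eq (Prod.dist_eq).symm
  have h7 := h4.add (hint u.1)
  rw [zero_add] at h7
  exact h7.congr fun N => by ring

end Stability

/-! ### Exponential bounds on the residue and jump weights -/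

section Weights

/-- The residue coefficient at `i s` for unit weight of the pole. -/
noncomputable def upperBase (a b α β : ℝ) (r : ℂ → ℝ) (x t s : ℝ) : ℂ :=
  I * (b - a) * r (I * s) / Real.pi * exp (2 * I * phase α β x t (I * s))

/-- The residue coefficient at `-i s` for unit weight of the pole. -/
noncomputable def lowerBase (a b α β : ℝ) (r : ℂ → ℝ) (x t s : ℝ) : ℂ :=
  I * (b - a) * r (I * s) / Real.pi * exp (-(2 * I * phase α β x t (-(I * s))))

variable {a b α β : ℝ} {r : ℂ → ℝ} {p : ℝ → ℝ} {x t : ℝ}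

theorem upperCoeff_eq (N : ℕ) (s : ℝ) :
    upperCoeff a b α β r N x t s = upperBase a b α β r x t s / N := by
  rw [upperCoeff, normingConst, upperBase]
  ring

/-- As `r` is real, `c` is purely imaginary and `-c* = c`, so both coefficients share the factor
`r(is)`. The symmetry of `r` is needed only for `lowerWeight`, which involves `r(-is)`. -/
theorem lowerCoeff_eq (N : ℕ) (s : ℝ) :
    lowerCoeff a b α β r N x t s = lowerBase a b α β r x t s / N := by
  rw [lowerCoeff, normingConst, lowerBase]
  simp only [map_div₀, map_mul, map_sub, conj_I, conj_ofReal, map_natCast]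
  ring

theorem upperWeight_eq (s : ℝ) :
    upperWeight a b α β r p x t s = upperBase a b α β r x t s * p s := by
  rw [upperWeight, upperBase]
  ring

theorem lowerWeight_eq {s : ℝ} (hs : r (-(I * s)) = r (I * s)) :
    lowerWeight a b α β r p x t s = lowerBase a b α β r x t s * p s := by
  rw [lowerWeight, lowerBase, hs]
  ring

/-- On the imaginary axis the `α` part of the exponent is purely imaginary and drops out of the
modulus. -/
theorem norm_exp_upper (α β x t s : ℝ) :
    ‖exp (2 * I * phase α β x t (I * s))‖ = Real.exp (-2 * s * x + 8 * β * s ^ 3 * t) := by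
  have h : 2 * I * phase α β x t (I * s) = ((-2 * s * x + 8 * β * s ^ 3 * t : ℝ) : ℂ) +
      ((-4 * α * s ^ 2 * t : ℝ) : ℂ) * I := by
    rw [phase]
    push_cast
    linear_combination (2 * s * x : ℂ) * I_sq + (8 * β * s ^ 3 * t : ℂ) * I_pow_four +
      (4 * α * s ^ 2 * t : ℂ) * I_pow_three
  rw [h, norm_exp, add_re, ofReal_re, re_ofReal_mul, I_re, mul_zero, add_zero]

theorem norm_exp_lower (α β x t s : ℝ) :
    ‖exp (-(2 * I * phase α β x t (-(I * s))))‖ =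
      Real.exp (-2 * s * x + 8 * β * s ^ 3 * t) := by
  have h : -(2 * I * phase α β x t (-(I * s))) = ((-2 * s * x + 8 * β * s ^ 3 * t : ℝ) : ℂ) +
      ((4 * α * s ^ 2 * t : ℝ) : ℂ) * I := by
    rw [phase]
    push_cast
    linear_combination (2 * s * x : ℂ) * I_sq + (8 * β * s ^ 3 * t : ℂ) * I_pow_four -
      (4 * α * s ^ 2 * t : ℂ) * I_pow_three
  rw [h, norm_exp, add_re, ofReal_re, re_ofReal_mul, I_re, mul_zero, add_zero]

/-- The constant in the exponential bound of the data. -/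
noncomputable def dataBound (a b β t K : ℝ) : ℝ :=
  (b - a) * K / Real.pi * Real.exp (8 * |β| * b ^ 3 * |t|)

theorem dataBound_nonneg {K : ℝ} (hab : a ≤ b) (hK : 0 ≤ K) : 0 ≤ dataBound a b β t K := by
  have := sub_nonneg.2 hab
  unfold dataBound
  positivity

theorem exp_phase_le (ha : 0 < a) (hx : 0 ≤ x) {s : ℝ} (hs : s ∈ Set.Icc a b) :
    Real.exp (-2 * s * x + 8 * β * s ^ 3 * t) ≤
      Real.exp (8 * |β| * b ^ 3 * |t|) * Real.exp (-(2 * a) * x) := by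
  have hs0 : 0 ≤ s := ha.le.trans hs.1
  rw [← Real.exp_add, Real.exp_le_exp]
  have h1 : a * x ≤ s * x := mul_le_mul_of_nonneg_right hs.1 hx
  have h2 : 8 * β * s ^ 3 * t ≤ 8 * |β| * b ^ 3 * |t| := by
    refine (le_abs_self _).trans ?_
    rw [abs_mul, abs_mul, abs_mul, abs_of_nonneg (pow_nonneg hs0 3), abs_of_pos (by norm_num)]
    gcongr
    exact hs.2
  linarith

theorem norm_prefactor_le {K : ℝ} (hab : a ≤ b) {s : ℝ} (hK : |r (I * s)| ≤ K) :
    ‖I * ((b : ℂ) - a) * r (I * s) / Real.pi‖ ≤ (b - a) * K / Real.pi := by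
  have hba := sub_nonneg.2 hab
  rw [norm_div, norm_mul, norm_mul, norm_I, one_mul, ← ofReal_sub, norm_real, norm_real, norm_real,
    Real.norm_of_nonneg hba, Real.norm_of_nonneg Real.pi_pos.le, Real.norm_eq_abs]
  gcongr

theorem norm_upperBase_le {K : ℝ} (ha : 0 < a) (hab : a ≤ b) (hx : 0 ≤ x) {s : ℝ}
    (hs : s ∈ Set.Icc a b) (hK : |r (I * s)| ≤ K) :
    ‖upperBase a b α β r x t s‖ ≤ dataBound a b β t K * Real.exp (-(2 * a) * x) := by
  rw [upperBase, norm_mul, norm_exp_upper, dataBound, mul_assoc _ (Real.exp _)]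
  exact mul_le_mul (norm_prefactor_le hab hK) (exp_phase_le ha hx hs) (Real.exp_pos _).le
    ((norm_nonneg _).trans (norm_prefactor_le hab hK))

theorem norm_lowerBase_le {K : ℝ} (ha : 0 < a) (hab : a ≤ b) (hx : 0 ≤ x) {s : ℝ}
    (hs : s ∈ Set.Icc a b) (hK : |r (I * s)| ≤ K) :
    ‖lowerBase a b α β r x t s‖ ≤ dataBound a b β t K * Real.exp (-(2 * a) * x) := by
  rw [lowerBase, norm_mul, norm_exp_lower, dataBound, mul_assoc _ (Real.exp _)]
  exact mul_le_mul (norm_prefactor_le hab hK) (exp_phase_le ha hx hs) (Real.exp_pos _).le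
    ((norm_nonneg _).trans (norm_prefactor_le hab hK))

theorem continuousOn_upperBase (hr : ContinuousOn (fun s : ℝ => r (I * s)) (Set.Ioo a b)) :
    ContinuousOn (upperBase a b α β r x t) (Set.Ioo a b) := by
  have hr' : ContinuousOn (fun s : ℝ => (r (I * s) : ℂ)) (Set.Ioo a b) :=
    continuous_ofReal.comp_continuousOn hr
  exact ((hr'.const_smul (I * ((b : ℂ) - a))).div_const _).mul
    (by unfold phase; fun_prop : Continuous fun s : ℝ =>
      exp (2 * I * phase α β x t (I * s))).continuousOn

theorem continuousOn_lowerBase (hr : ContinuousOn (fun s : ℝ => r (I * s)) (Set.Ioo a b)) :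
    ContinuousOn (lowerBase a b α β r x t) (Set.Ioo a b) := by
  have hr' : ContinuousOn (fun s : ℝ => (r (I * s) : ℂ)) (Set.Ioo a b) :=
    continuous_ofReal.comp_continuousOn hr
  exact ((hr'.const_smul (I * ((b : ℂ) - a))).div_const _).mul
    (by unfold phase; fun_prop : Continuous fun s : ℝ =>
      exp (-(2 * I * phase α β x t (-(I * s))))).continuousOn

end Weights

/-! ### Comparison of the soliton and gas data -/

section Comparison

variable {a b : ℝ} {p : ℝ → ℝ}

theorem norm_div_natCast_le {E : ℝ} (hE : 0 ≤ E) (N : ℕ) {W : ℂ} (hW : ‖W‖ ≤ E) :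
    ‖W / N‖ ≤ E := by
  rw [norm_div, norm_natCast]
  -- For `N = 0` the quotient is zero by convention.
  rcases Nat.eq_zero_or_pos N with h0 | h0
  · simpa [h0] using hE
  · exact (div_le_self (norm_nonneg _) (by exact_mod_cast h0)).trans hW

theorem integral_norm_solitonMeasure_le {N : ℕ} {s : Fin N → ℝ} {W v : ℝ → ℂ} {E : ℝ}
    (hE : 0 ≤ E) (hv : ∀ y, v y = W y / N) (hW : ∀ j, ‖W (s j)‖ ≤ E) :
    ∫ y, ‖v y‖ ∂(solitonMeasure s) ≤ E := by
  rw [integral_solitonMeasure]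
  simp only [hv, norm_div, norm_natCast]
  rcases Nat.eq_zero_or_pos N with h0 | h0
  · subst h0; simpa using hE
  have hN : (0 : ℝ) < N := by exact_mod_cast h0
  calc ∑ j, ‖W (s j)‖ / (N : ℝ) ≤ ∑ _j : Fin N, E / N := by
        gcongr with j
        exact hW j
    _ = E := by
        rw [Finset.sum_const, Finset.card_univ, Fintype.card_fin, nsmul_eq_mul]
        field_simp

namespace IsContDensity

variable (hp : IsContDensity a b p)
include hp

/-- The base function is continuous only on the open interval; the endpoints are null. Since `p` has
mass one, a pointwise bound `E` becomes a bound `E` on the total mass. -/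
theorem integrable_weight {W w : ℝ → ℂ} {E : ℝ} (hWc : ContinuousOn W (Set.Ioo a b))
    (hW : ∀ y ∈ Set.Icc a b, ‖W y‖ ≤ E) (hw : ∀ y ∈ Set.Ioo a b, w y = W y * p y) :
    Integrable w (volume.restrict (Set.Ioc a b)) ∧
      ∫ y, ‖w y‖ ∂(volume.restrict (Set.Ioc a b)) ≤ E := by
  have hpi : IntegrableOn p (Set.Ioc a b) :=
    (hp.intervalIntegrable hp.left_mem hp.right_mem).1
  have hae : ∀ᵐ y ∂(volume.restrict (Set.Ioc a b)), y ∈ Set.Ioo a b := by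
    rw [← restrict_Ioo_eq_restrict_Ioc]
    exact ae_restrict_mem measurableSet_Ioo
  have hmeas : AEStronglyMeasurable w (volume.restrict (Set.Ioc a b)) := by
    rw [← restrict_Ioo_eq_restrict_Ioc]
    refine ContinuousOn.aestronglyMeasurable ?_ measurableSet_Ioo
    exact (hWc.mul (continuous_ofReal.comp_continuousOn
      (hp.cont.mono Set.Ioo_subset_Icc_self))).congr hw
  have hbound : ∀ᵐ y ∂(volume.restrict (Set.Ioc a b)), ‖w y‖ ≤ E * p y := by
    filter_upwards [hae] with y hy
    have hyI := Set.Ioo_subset_Icc_self hy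
    rw [hw y hy, norm_mul, norm_real, Real.norm_of_nonneg (hp.nonneg y hyI)]
    exact mul_le_mul_of_nonneg_right (hW y hyI) (hp.nonneg y hyI)
  have hi : Integrable w (volume.restrict (Set.Ioc a b)) := (hpi.const_mul E).mono' hmeas hbound
  refine ⟨hi, (integral_mono_ae hi.norm (hpi.const_mul E) hbound).trans (le_of_eq ?_)⟩
  rw [integral_const_mul, ← intervalIntegral.integral_of_le hp.lt.le, hp.mass, mul_one]

/-- The test functions are `kernel a σ`, with bound and Lipschitz constant independent of `σ`, so
the convergence of the transforms holds in the sup norm. The test function `1` gives the convergence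
of the plain integrals. -/
theorem tendsto_quantile_operators {s : (N : ℕ) → Fin N → ℝ} (hs : ∀ N j, s N j ∈ Set.Icc a b)
    (hq : ∀ N (j : Fin N), ∫ y in a..s N j, p y = ((j : ℕ) + 1 : ℝ) / N) (ha : 0 < a)
    {W w : ℝ → ℂ} {v : ℕ → ℝ → ℂ} {E : ℝ} (hWc : ContinuousOn W (Set.Ioo a b))
    (hW : ∀ y ∈ Set.Icc a b, ‖W y‖ ≤ E) (hw : ∀ y ∈ Set.Ioo a b, w y = W y * p y)
    (hv : ∀ N y, v N y = W y / N) (hwi : Integrable w (volume.restrict (Set.Ioc a b)))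
    (hvi : ∀ N, Integrable (v N) (solitonMeasure (s N))) (f : BoundedContinuousFunction ℝ ℂ) :
    Tendsto (fun N => dist (kernelTransform ha (integrable_mul_bcf (hvi N) f))
        (kernelTransform ha (integrable_mul_bcf hwi f))) atTop (𝓝 0) ∧
      Tendsto (fun N => ∫ y, v N y * f y ∂(solitonMeasure (s N))) atTop
        (𝓝 (∫ y, w y * f y ∂(volume.restrict (Set.Ioc a b)))) := by
  have hHc : ContinuousOn (fun y => W y * f y) (Set.Ioo a b) := hWc.mul f.continuous.continuousOn
  have hHb : ∀ y ∈ Set.Icc a b, ‖W y * f y‖ ≤ E * ‖f‖ := fun y hy => by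
    rw [norm_mul]
    exact mul_le_mul (hW y hy) (f.norm_coe_le_norm y) (norm_nonneg _)
      ((norm_nonneg _).trans (hW y hy))
  have hsum : ∀ N (k : ℝ → ℂ), ∫ y, v N y * f y * k y ∂(solitonMeasure (s N)) =
      ∑ j, W (s N j) * f (s N j) * k (s N j) / N := fun N k => by
    rw [integral_solitonMeasure]
    refine Finset.sum_congr rfl fun j _ => ?_
    rw [hv]; ring
  have hint : ∀ k : ℝ → ℂ, ∫ y, w y * f y * k y ∂(volume.restrict (Set.Ioc a b)) =
      ∫ y in a..b, W y * f y * k y * p y := fun k => by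
    rw [intervalIntegral.integral_of_le hp.lt.le, ← restrict_Ioo_eq_restrict_Ioc]
    refine integral_congr_ae ?_
    filter_upwards [ae_restrict_mem measurableSet_Ioo] with y hy
    rw [hw y hy]; ring
  constructor
  · obtain ⟨η, hη, hbound⟩ := hp.exists_uniform_quantile_bound hs hq hHc hHb (2 * a)⁻¹
      ((2 * a)⁻¹ * (2 * a)⁻¹)
    refine squeeze_zero' (Eventually.of_forall fun _ => dist_nonneg) ?_ hη
    filter_upwards [hbound] with N hN
    have hN' : ∀ σ : ℝ, dist (kernelTransform ha (integrable_mul_bcf (hvi N) f) σ)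
        (kernelTransform ha (integrable_mul_bcf hwi f) σ) ≤ η N := fun σ => by
      rw [dist_eq_norm, kernelTransform_apply, kernelTransform_apply, hsum, hint]
      exact hN (kernel a σ) ((continuous_kernel ha).comp (by fun_prop : Continuous fun y : ℝ =>
        (σ, y))) (norm_kernel_le ha σ) (norm_kernel_sub_le ha σ)
    exact (BoundedContinuousFunction.dist_le (dist_nonneg.trans (hN' 0))).2 hN'
  · obtain ⟨η, hη, hbound⟩ := hp.exists_uniform_quantile_bound hs hq hHc hHb 1 0
    refine tendsto_iff_norm_sub_tendsto_zero.2 ?_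
    refine squeeze_zero' (Eventually.of_forall fun _ => norm_nonneg _) ?_ hη
    filter_upwards [hbound] with N hN
    have h1 := hN (fun _ => 1) continuous_const (by simp) (by simp)
    rwa [← hsum N fun _ => 1, ← hint fun _ => 1, integral_congr_ae (ae_of_all _ fun y => mul_one _),
      integral_congr_ae (ae_of_all _ fun y => mul_one _)] at h1

end IsContDensity

/-- Distinct indices prescribe distinct cumulative masses, even where `p` vanishes. -/
theorem quantile_injective {N : ℕ} {s : Fin N → ℝ}
    (hq : ∀ j : Fin N, ∫ y in a..s j, p y = ((j : ℕ) + 1 : ℝ) / N) : Function.Injective s := by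
  intro j k hjk
  have hN : (N : ℝ) ≠ 0 := by
    have : 0 < N := j.pos
    exact_mod_cast this.ne'
  have h1 := hq j
  rw [hjk, hq k, div_left_inj' hN, add_left_inj] at h1
  exact Fin.ext (by exact_mod_cast h1.symm)

theorem norm_cauchyTransform_le {μ : Measure ℝ} {J z : ℂ} {h : ℝ → ℂ} {δ : ℝ} (hδ : 0 < δ)
    (hμ : ∀ᵐ y ∂μ, y ∈ Set.Icc a b) (hh : Integrable h μ)
    (hz : ∀ y ∈ Set.Icc a b, δ ≤ ‖z - J * y‖) :
    ‖cauchyTransform μ J h z‖ ≤ (∫ y, ‖h y‖ ∂μ) / δ := by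
  rw [← integral_div]
  refine norm_integral_le_of_norm_le (hh.norm.div_const δ) ?_
  filter_upwards [hμ] with y hy
  rw [norm_div]
  gcongr
  exact hz y hy

theorem sphere_sub_le {ρ : ℝ} {z : ℂ} (hz : z ∈ Metric.sphere (centre a b) ρ) :
    ∀ y ∈ Set.Icc a b, ρ - (b - a) / 2 ≤ ‖z - I * y‖ := by
  intro y hy
  have h1 : I * (y : ℂ) - centre a b = I * ((y - (a + b) / 2 : ℝ) : ℂ) := by
    rw [centre]; push_cast; ring
  have h2 : ‖I * (y : ℂ) - centre a b‖ ≤ (b - a) / 2 := by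
    rw [h1, norm_mul, norm_I, one_mul, norm_real, Real.norm_eq_abs, abs_le]
    constructor <;> linarith [hy.1, hy.2]
  have h3 := norm_sub_le_norm_sub_add_norm_sub z (I * (y : ℂ)) (centre a b)
  rw [mem_sphere_iff_norm] at hz
  linarith

theorem sphere_neg_sub_le {ρ : ℝ} {z : ℂ} (hz : z ∈ Metric.sphere (-centre a b) ρ) :
    ∀ y ∈ Set.Icc a b, ρ - (b - a) / 2 ≤ ‖z - -I * y‖ := by
  intro y hy
  have h1 : -z ∈ Metric.sphere (centre a b) ρ := by
    rw [mem_sphere_iff_norm] at hz ⊢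
    rwa [← norm_neg, show -(-z - centre a b) = z - -centre a b by ring]
  have h2 := sphere_sub_le h1 y hy
  rwa [← norm_neg, show -(-z - I * y) = z - -I * y by ring] at h2

end Comparison

end SolitonGas

/-! ### Choice of the constants and assembly -/

theorem mainTheorem6 (a b α β t₀ ρ : ℝ) (ha : 0 < a) (hab : a < b)
    -- the circles of radius `ρ` about `± i (a+b)/2` enclose `± i [a,b]` and miss the real axis
    (hρ₁ : (b - a) / 2 < ρ) (hρ₂ : ρ < (a + b) / 2)
    (r : ℂ → ℝ)
    (hr_cont : ContinuousOn (fun s : ℝ => r (Complex.I * s)) (Set.Ioo a b))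
    (hr_bdd : ∃ K : ℝ, ∀ s ∈ Set.Ioo a b, |r (Complex.I * s)| ≤ K)
    (hr_symm : ∀ s ∈ Set.Ioo a b, r (-(Complex.I * s)) = r (Complex.I * s))
    (p : ℝ → ℝ) (hp_cont : ContinuousOn p (Set.Icc a b))
    (hp_nonneg : ∀ s ∈ Set.Icc a b, 0 ≤ p s) (hp_mass : ∫ s in a..b, p s = 1)
    (s : (N : ℕ) → Fin N → ℝ) (hs_mem : ∀ N j, s N j ∈ Set.Icc a b)
    (hs_quantile : ∀ N (j : Fin N), ∫ y in a..s N j, p y = ((j : ℕ) + 1 : ℝ) / N) :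
    ∃ (X C c : ℝ) (qN : ℕ → ℝ → ℂ) (q : ℝ → ℂ), 0 < c ∧ ∀ x : ℝ, X ≤ x →
      -- the residue and jump data are exponentially small
      (∀ N (j : Fin N),
        ‖SolitonGas.upperCoeff a b α β r N x t₀ (s N j)‖ ≤ C * Real.exp (-c * x) ∧
        ‖SolitonGas.lowerCoeff a b α β r N x t₀ (s N j)‖ ≤ C * Real.exp (-c * x)) ∧
      (∀ z ∈ Metric.sphere (SolitonGas.centre a b) ρ,
        ‖SolitonGas.upperCauchy a b α β r p x t₀ z‖ ≤ C * Real.exp (-c * x)) ∧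
      (∀ z ∈ Metric.sphere (-SolitonGas.centre a b) ρ,
        ‖SolitonGas.lowerCauchy a b α β r p x t₀ z‖ ≤ C * Real.exp (-c * x)) ∧
      -- the `N`-soliton potentials are exponentially small, uniformly in `N`
      (∀ N, SolitonGas.IsNSolitonPotential a b α β r N (s N) x t₀ (qN N x) ∧
        ‖qN N x‖ ≤ C * Real.exp (-c * x)) ∧
      -- so is the soliton gas potential, their limit, given by the limiting RH problem
      Filter.Tendsto (fun N => qN N x) Filter.atTop (nhds (q x)) ∧
      SolitonGas.IsGasPotential a b α β ρ r p x t₀ (q x) ∧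
      ‖q x‖ ≤ C * Real.exp (-c * x) := by
  have hp : SolitonGas.IsContDensity a b p := ⟨hab, hp_cont, hp_nonneg, hp_mass⟩
  obtain ⟨K₀, hK₀⟩ := hr_bdd
  -- The bound is extended to the endpoints because a quantile may equal `b`, and nothing is assumed
  -- about the size of `r` there.
  obtain ⟨K, hK⟩ : ∃ K : ℝ, ∀ y ∈ Set.Icc a b, |r (Complex.I * y)| ≤ K := by
    refine ⟨max K₀ (max |r (Complex.I * a)| |r (Complex.I * b)|), fun y hy => ?_⟩
    rcases hy.1.eq_or_lt with rfl | h1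
    · exact (le_max_left _ _).trans (le_max_right _ _)
    rcases hy.2.eq_or_lt with rfl | h2
    · exact (le_max_right _ _).trans (le_max_right _ _)
    · exact (hK₀ y ⟨h1, h2⟩).trans (le_max_left _ _)
  set B := SolitonGas.dataBound a b β t₀ K
  have hB : 0 ≤ B := SolitonGas.dataBound_nonneg hab.le
    ((abs_nonneg _).trans (hK a (Set.left_mem_Icc.2 hab.le)))
  set E : ℝ → ℝ := fun x => B * Real.exp (-(2 * a) * x)
  have hE : ∀ x, 0 ≤ E x := fun x => mul_nonneg hB (Real.exp_pos _).le
  set δ := ρ - (b - a) / 2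
  have hδ : 0 < δ := sub_pos.2 hρ₁
  -- `E x ≤ a` is the smallness required by `SmallData`; `0 ≤ x` allows `e^{-2sx} ≤ e^{-2ax}` for `s
  -- ≥ a`.
  have hX : ∃ X, ∀ x, X ≤ x → 0 ≤ x ∧ E x ≤ a := by
    have h1 : Filter.Tendsto E Filter.atTop (nhds (B * 0)) :=
      (Real.tendsto_exp_atBot.comp
        (Filter.tendsto_id.const_mul_atTop_of_neg (by linarith))).const_mul B
    rw [mul_zero] at h1
    exact Filter.eventually_atTop.1
      ((Filter.eventually_ge_atTop 0).and (h1.eventually_le_const ha))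
  obtain ⟨X, hX⟩ := hX
  have hWp : ∀ x, X ≤ x → ∀ y ∈ Set.Icc a b,
      ‖SolitonGas.upperBase a b α β r x t₀ y‖ ≤ E x := fun x hx y hy =>
    SolitonGas.norm_upperBase_le ha hab.le (hX x hx).1 hy (hK y hy)
  have hWm : ∀ x, X ≤ x → ∀ y ∈ Set.Icc a b,
      ‖SolitonGas.lowerBase a b α β r x t₀ y‖ ≤ E x := fun x hx y hy =>
    SolitonGas.norm_lowerBase_le ha hab.le (hX x hx).1 hy (hK y hy)
  have hup : ∀ x N, X ≤ x → ∫ y, ‖SolitonGas.upperCoeff a b α β r N x t₀ y‖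
      ∂(SolitonGas.solitonMeasure (s N)) ≤ E x := fun x N hx =>
    SolitonGas.integral_norm_solitonMeasure_le (hE x) (SolitonGas.upperCoeff_eq N)
      fun j => hWp x hx _ (hs_mem N j)
  have hlow : ∀ x N, X ≤ x → ∫ y, ‖SolitonGas.lowerCoeff a b α β r N x t₀ y‖
      ∂(SolitonGas.solitonMeasure (s N)) ≤ E x := fun x N hx =>
    SolitonGas.integral_norm_solitonMeasure_le (hE x) (SolitonGas.lowerCoeff_eq N)
      fun j => hWm x hx _ (hs_mem N j)
  have hgup : ∀ x, X ≤ x → _ := fun x hx =>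
    hp.integrable_weight (SolitonGas.continuousOn_upperBase (x := x) (t := t₀) (α := α) (β := β)
      hr_cont) (hWp x hx) fun y _ => SolitonGas.upperWeight_eq (p := p) y
  have hglow : ∀ x, X ≤ x → _ := fun x hx =>
    hp.integrable_weight (SolitonGas.continuousOn_lowerBase (x := x) (t := t₀) (α := α) (β := β)
      hr_cont) (hWm x hx) fun y hy => SolitonGas.lowerWeight_eq (p := p) (hr_symm y hy)
  have hN : ∀ x N, X ≤ x → SolitonGas.SolitonData a b α β r N (s N) x t₀ := fun x N hx =>
    ⟨ha, SolitonGas.integrable_solitonMeasure _ _, SolitonGas.integrable_solitonMeasure _ _,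
      (hup x N hx).trans (hX x hx).2, (hlow x N hx).trans (hX x hx).2⟩
  have hG : ∀ x, X ≤ x → SolitonGas.GasData a b α β r p x t₀ := fun x hx =>
    ⟨ha, (hgup x hx).1, (hglow x hx).1, (hgup x hx).2.trans (hX x hx).2,
      (hglow x hx).2.trans (hX x hx).2⟩
  classical
  -- `4B` serves the potentials, and also the residue coefficients, which need only `B`. `B / δ`
  -- serves `F₊` and `F₋`, as `δ` bounds below the distance from each circle to the segment it
  -- encloses.
  set C := 4 * B + B / δ
  have hC1 : ∀ x y, y ≤ E x → y ≤ C * Real.exp (-(2 * a) * x) := fun x y hy => by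
    refine hy.trans (mul_le_mul_of_nonneg_right ?_ (Real.exp_pos _).le)
    linarith [div_nonneg hB hδ.le]
  have hC4 : ∀ x y, y ≤ 4 * E x → y ≤ C * Real.exp (-(2 * a) * x) := fun x y hy => by
    refine hy.trans ?_
    rw [← mul_assoc]
    exact mul_le_mul_of_nonneg_right (le_add_of_nonneg_right (div_nonneg hB hδ.le))
      (Real.exp_pos _).le
  have hCδ : ∀ x y, y ≤ E x / δ → y ≤ C * Real.exp (-(2 * a) * x) := fun x y hy => by
    refine hy.trans ?_
    rw [mul_div_right_comm]
    exact mul_le_mul_of_nonneg_right (le_add_of_nonneg_left (by linarith)) (Real.exp_pos _).le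
  -- The value `0` for `x < X` is arbitrary: nothing is claimed there.
  refine ⟨X, C, 2 * a, fun N x => if hx : X ≤ x then (hN x N hx).potential else 0,
    fun x => if hx : X ≤ x then (hG x hx).potential else 0, by linarith, fun x hx => ?_⟩
  simp only [dif_pos hx]
  refine ⟨fun N j => ⟨hC1 x _ ?_, hC1 x _ ?_⟩, fun z hz => hCδ x _ ?_, fun z hz => hCδ x _ ?_,
    fun N => ⟨?_, hC4 x _ ?_⟩, ?_, ?_, hC4 x _ ?_⟩
  · rw [SolitonGas.upperCoeff_eq]
    exact SolitonGas.norm_div_natCast_le (hE x) N (hWp x hx _ (hs_mem N j))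
  · rw [SolitonGas.lowerCoeff_eq]
    exact SolitonGas.norm_div_natCast_le (hE x) N (hWm x hx _ (hs_mem N j))
  · rw [SolitonGas.upperCauchy_eq hab.le]
    refine (SolitonGas.norm_cauchyTransform_le hδ (SolitonGas.ae_mem_Icc a b) (hgup x hx).1
      (SolitonGas.sphere_sub_le hz)).trans ?_
    gcongr
    exact (hgup x hx).2
  · rw [SolitonGas.lowerCauchy_eq hab.le]
    refine (SolitonGas.norm_cauchyTransform_le hδ (SolitonGas.ae_mem_Icc a b) (hglow x hx).1
      (SolitonGas.sphere_neg_sub_le hz)).trans ?_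
    gcongr
    exact (hglow x hx).2
  · exact SolitonGas.isNSolitonPotential ha (hN x N hx) (hs_mem N)
      (SolitonGas.quantile_injective (hs_quantile N))
  · refine (hN x N hx).norm_potential_le.trans ?_
    gcongr
    exact hlow x N hx
  · have h1 := hp.tendsto_quantile_operators hs_mem hs_quantile ha
      (SolitonGas.continuousOn_upperBase hr_cont) (hWp x hx)
      (fun y _ => SolitonGas.upperWeight_eq (p := p) y) (fun N => SolitonGas.upperCoeff_eq N)
      (hgup x hx).1 (fun N => (hN x N hx).integrable_upper)
    have h2 := hp.tendsto_quantile_operators hs_mem hs_quantile ha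
      (SolitonGas.continuousOn_lowerBase hr_cont) (hWm x hx)
      (fun y hy => SolitonGas.lowerWeight_eq (p := p) (hr_symm y hy))
      (fun N => SolitonGas.lowerCoeff_eq N)
      (hglow x hx).1 (fun N => (hN x N hx).integrable_lower)
    exact SolitonGas.SmallData.tendsto_potential (fun N => hN x N hx) (hG x hx)
      (fun f => (h1 f).1) (fun f => (h2 f).1) (fun f => (h2 f).2)
  · exact SolitonGas.isGasPotential (hG x hx) hab.le hρ₁ hρ₂
  · refine (hG x hx).norm_potential_le.trans ?_
    gcongr
    exact (hglow x hx).2
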